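/- Let $\Omega\subset\mathbb R^n$ be a bounded polygonal (polyhedral) domain, i.e. a nonempty connected open set that is the interior of its closure, $\overline\Omega$ being a finite union of nondegenerate $n$-simplices. Let $\partial\Omega=\Gamma_1\cup\Gamma_2$ with $\Gamma_1,\Gamma_2$ disjoint and measurable and $\Gamma_1$ of positive surface measure. Put $V=H^1(\Omega)$, $H=L^2(\Omega)$, $Q=L^2(\Gamma_2)$, $R=L^2(\Gamma_1)$, $K_+=\{v\in V: v\ge 0 \text{ in }\Omega\}$, and, for $\alpha>0$, $$a_\alpha(u,v)=\int_\Omega\nabla u\cdot\nabla v\,dx+\alpha\int_{\Gamma_1}uv\,ds ,$$ where boundary values are understood as traces. Let $b>0$ be a constant, $q\in Q$, and fix $\alpha>0$ and a control $g\in H$. The continuous state $u_{\alpha g}$ is the solution of: $u_{\alpha g}\in K_+$ and $$a_\alpha(u_{\alpha g},v-u_{\alpha g})\ \ge\ (g,v-u_{\alpha g})_H-(q,v-u_{\alpha g})_Q+\alpha(b,v-u_{\alpha g})_R\qquad\forall v\in K_+ .$$ Let $(\tau_h)$ be a regular family of conforming triangulations of $\overline\Omega$ by $n$-simplices (regular: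 for some $\kappa>0$ independent of $h$, every element $T$ contains a ball of radius $\kappa\,\mathrm{diam}\,T$), where $h$ is the longest side of the elements of $\tau_h$. Let $$V_h=\{v_h\in C^0(\overline\Omega): v_h|_T \text{ is a polynomial of degree}\le 1\ \ \forall T\in\tau_h\},\qquad K_{+h}=\{v_h\in V_h: v_h\ge0\text{ in }\Omega\},$$ and let the discrete state $u_{h\alpha g}$ be the solution of: $u_{h\alpha g}\in K_{+h}$ and $$a_\alpha(u_{h\alpha g},v_h-u_{h\alpha g})\ \ge\ (g,v_h-u_{h\alpha g})_H-(q,v_h-u_{h\alpha g})_Q+\alpha(b,v_h-u_{h\alpha g})_R\qquad\forall v_h\in K_{+h}.$$ **Theorem 3.1.** If $u_{\alpha g}\in K_+\cap H^r(\Omega)$ for some $1<r\le2$, then $u_{h\alpha g}\to u_{\alpha g}$ strongly in $V$ as $h\to0^+$, that is, $\lim_{h\to0^+}\|u_{h\alpha g}-u_{\alpha g}\|_V=0$. -/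

import Mathlib

open Set Filter Topology MeasureTheory
open scoped ContDiff ENNReal RealInnerProductSpace

noncomputable section

namespace ObstacleFEM

/-- The Euclidean space of dimension `n`. -/
abbrev E (n : ℕ) : Type := EuclideanSpace ℝ (Fin n)

/-! ### Domains and triangulations -/

/-- A bounded polygonal (polyhedral) domain: a nonempty connected open set which is the interior of
its closure (no slits), the closure being a finite union of nondegenerate `n`-simplices. -/
structure IsPolygonalDomain {n : ℕ} (Ω : Set (E n)) : Prop where
  isOpen : IsOpen Ω
  isConnected : IsConnected Ω
  interior_closure : interior (closure Ω) = Ω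
  exists_simplices : ∃ S : Finset (Finset (E n)),
    (∀ s ∈ S, s.card = n + 1 ∧ AffineIndependent ℝ ((↑) : s → E n)) ∧
      closure Ω = ⋃ s ∈ S, convexHull ℝ (s : Set (E n))

/-- A (conforming) triangulation of the closure of `Ω`: a finite geometric simplicial complex, all
of whose simplices are faces of `n`-simplices of the complex, with union the closure of `Ω`. -/
structure Triangulation {n : ℕ} (Ω : Set (E n)) where
  complex : Geometry.SimplicialComplex ℝ (E n)
  finite_faces : complex.faces.Finite
  pure : ∀ s ∈ complex.faces, ∃ t ∈ complex.faces, s ⊆ t ∧ t.card = n + 1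
  space_eq : complex.space = closure Ω

namespace Triangulation

variable {n : ℕ} {Ω : Set (E n)}

/-- The elements of the triangulation: its `n`-simplices, given by their sets of vertices. -/
def cells (𝒯 : Triangulation Ω) : Set (Finset (E n)) :=
  {s | s ∈ 𝒯.complex.faces ∧ s.card = n + 1}

/-- The mesh size `h`: the longest side of the elements of the triangulation. -/
def meshSize (𝒯 : Triangulation Ω) : ℝ :=
  sSup {d : ℝ | ∃ s ∈ 𝒯.cells, ∃ x ∈ s, ∃ y ∈ s, d = dist x y}

end Triangulation

/-- A family of triangulations is regular (shape regular) if, with one constant `κ > 0` for the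
whole family, each element `T` contains a closed ball of radius `κ * diam T`. -/
def IsRegularFamily {n : ℕ} {Ω : Set (E n)} {ι : Type*} (𝒯 : ι → Triangulation Ω) : Prop :=
  ∃ κ : ℝ, 0 < κ ∧ ∀ i, ∀ s ∈ (𝒯 i).cells, ∃ c : E n,
    Metric.closedBall c (κ * Metric.diam (convexHull ℝ (s : Set (E n)))) ⊆
      convexHull ℝ (s : Set (E n))

/-! ### Function spaces -/

/-- The space `H = L²(Ω)`. -/
abbrev L2 {n : ℕ} (Ω : Set (E n)) : Type := Lp ℝ 2 (volume.restrict Ω)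

/-- Square integrable vector fields on `Ω`. -/
abbrev L2Vec {n : ℕ} (Ω : Set (E n)) : Type := Lp (E n) 2 (volume.restrict Ω)

/-- `G` is the weak gradient of `u` on `Ω`. -/
def IsWeakGradient {n : ℕ} (Ω : Set (E n)) (u : L2 Ω) (G : L2Vec Ω) : Prop :=
  ∀ φ : E n → ℝ, ContDiff ℝ ∞ φ → HasCompactSupport φ → tsupport φ ⊆ Ω →
    ∫ x in Ω, u x • gradient φ x = -∫ x in Ω, φ x • G x

section WeakGradient

variable {n : ℕ} {Ω : Set (E n)}

lemma continuous_gradient {φ : E n → ℝ} (hφ : ContDiff ℝ ∞ φ) : Continuous (gradient φ) :=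
  (InnerProductSpace.toDual ℝ (E n)).symm.continuous.comp (hφ.continuous_fderiv (by simp))

lemma hasCompactSupport_gradient {φ : E n → ℝ} (hφ : HasCompactSupport φ) :
    HasCompactSupport (gradient φ) :=
  (hφ.fderiv (𝕜 := ℝ)).comp_left (g := (InnerProductSpace.toDual ℝ (E n)).symm) (map_zero _)

lemma integrable_smul_gradient (u : L2 Ω) {φ : E n → ℝ} (hφ : ContDiff ℝ ∞ φ)
    (hc : HasCompactSupport φ) : Integrable (fun x => u x • gradient φ x) (volume.restrict Ω) :=
  ((Lp.memLp u).locallyIntegrable (by norm_num)).integrable_smul_right_of_hasCompactSupport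
    (continuous_gradient hφ) (hasCompactSupport_gradient hc)

lemma integrable_smul_field (G : L2Vec Ω) {φ : E n → ℝ} (hφ : ContDiff ℝ ∞ φ)
    (hc : HasCompactSupport φ) : Integrable (fun x => φ x • G x) (volume.restrict Ω) :=
  ((Lp.memLp G).locallyIntegrable (by norm_num)).integrable_smul_left_of_hasCompactSupport
    hφ.continuous hc

end WeakGradient

/-- The Sobolev space `V = H¹(Ω)`, as the subspace of the Hilbert space `L²(Ω) × L²(Ω; ℝⁿ)` of the
pairs `(u, ∇u)` where `∇u` is the weak gradient of `u`; it carries the norm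
`‖u‖_V² = ‖u‖_H² + ‖∇u‖²` and the corresponding inner product. -/
def sobolevH1 {n : ℕ} (Ω : Set (E n)) : Submodule ℝ (WithLp 2 (L2 Ω × L2Vec Ω)) where
  carrier := {p | IsWeakGradient Ω p.fst p.snd}
  zero_mem' := by
    intro φ _ _ _
    have h1 : ∫ x in Ω, (0 : L2 Ω) x • gradient φ x = 0 := by
      rw [integral_eq_zero_of_ae]
      filter_upwards [Lp.coeFn_zero ℝ 2 (volume.restrict Ω)] with x hx
      rw [hx, Pi.zero_apply, zero_smul, Pi.zero_apply]
    have h2 : ∫ x in Ω, φ x • (0 : L2Vec Ω) x = 0 := by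
      rw [integral_eq_zero_of_ae]
      filter_upwards [Lp.coeFn_zero (E n) 2 (volume.restrict Ω)] with x hx
      rw [hx, Pi.zero_apply, smul_zero]
    simp only [WithLp.zero_fst, WithLp.zero_snd, h1, h2, neg_zero]
  add_mem' := by
    intro p q hp hq φ h1 h2 h3
    have e1 : ∫ x in Ω, (p + q).fst x • gradient φ x =
        ∫ x in Ω, (p.fst x • gradient φ x + q.fst x • gradient φ x) := by
      refine integral_congr_ae ?_
      filter_upwards [Lp.coeFn_add p.fst q.fst] with x hx
      rw [WithLp.add_fst, hx, Pi.add_apply, add_smul]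
    have e2 : ∫ x in Ω, φ x • (p + q).snd x =
        ∫ x in Ω, (φ x • p.snd x + φ x • q.snd x) := by
      refine integral_congr_ae ?_
      filter_upwards [Lp.coeFn_add p.snd q.snd] with x hx
      rw [WithLp.add_snd, hx, Pi.add_apply, smul_add]
    rw [e1, e2, integral_add (integrable_smul_gradient _ h1 h2) (integrable_smul_gradient _ h1 h2),
      integral_add (integrable_smul_field _ h1 h2) (integrable_smul_field _ h1 h2),
      hp φ h1 h2 h3, hq φ h1 h2 h3, neg_add]
  smul_mem' := by
    intro c p hp φ h1 h2 h3
    have e1 : ∫ x in Ω, (c • p).fst x • gradient φ x =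
        ∫ x in Ω, c • (p.fst x • gradient φ x) := by
      refine integral_congr_ae ?_
      filter_upwards [Lp.coeFn_smul c p.fst] with x hx
      rw [WithLp.smul_fst, hx, Pi.smul_apply, smul_assoc]
    have e2 : ∫ x in Ω, φ x • (c • p).snd x = ∫ x in Ω, c • (φ x • p.snd x) := by
      refine integral_congr_ae ?_
      filter_upwards [Lp.coeFn_smul c p.snd] with x hx
      rw [WithLp.smul_snd, hx, Pi.smul_apply, smul_comm]
    rw [e1, e2, integral_smul, integral_smul, hp φ h1 h2 h3, smul_neg]

/-- The Sobolev space `V = H¹(Ω)`. -/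
abbrev H1 {n : ℕ} (Ω : Set (E n)) : Type := sobolevH1 Ω

namespace H1

variable {n : ℕ} {Ω : Set (E n)}

/-- The underlying square integrable function of an element of `H¹(Ω)`. -/
def toL2 (u : H1 Ω) : L2 Ω := u.1.fst

/-- The weak gradient of an element of `H¹(Ω)`. -/
def grad (u : H1 Ω) : L2Vec Ω := u.1.snd

/-- Membership of `u ∈ H¹(Ω)` in the Sobolev (Slobodeckij) space `H^r(Ω)`, for `1 < r ≤ 2`. If
`r < 2`, the Gagliardo seminorm of order `r - 1` of the gradient is finite; if `r = 2`, the first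
order partial derivatives belong to `H¹(Ω)`. -/
def MemHr (r : ℝ) (u : H1 Ω) : Prop :=
  if r < 2 then
    ∫⁻ x in Ω, ∫⁻ y in Ω,
      ENNReal.ofReal (‖u.grad x - u.grad y‖ ^ 2 / ‖x - y‖ ^ ((n : ℝ) + 2 * (r - 1))) < ⊤
  else
    ∀ j : Fin n, ∃ w : H1 Ω, ∀ᵐ x ∂volume.restrict Ω, w.toL2 x = u.grad x j

end H1

/-- The surface measure on the boundary of `Ω`: the `(n-1)`-dimensional Hausdorff measure,
normalized as usual in Euclidean geometry, on the topological boundary. -/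
def surfaceMeasure {n : ℕ} (Ω : Set (E n)) : Measure (E n) :=
  (Measure.euclideanHausdorffMeasure (n - 1)).restrict (frontier Ω)

/-- The space `L²(Γ)` for a portion `Γ` of the boundary of `Ω`. -/
abbrev L2Boundary {n : ℕ} (Ω Γ : Set (E n)) : Type := Lp ℝ 2 ((surfaceMeasure Ω).restrict Γ)

/-- `w` is the trace of `u ∈ H¹(Ω)` on the boundary: `w` is the limit in `L²(∂Ω)` of the boundary
values of functions smooth up to the boundary which converge to `u` in `H¹(Ω)`. -/
def IsTrace {n : ℕ} {Ω : Set (E n)} (u : H1 Ω) (w : Lp ℝ 2 (surfaceMeasure Ω)) : Prop :=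
  ∃ φ : ℕ → E n → ℝ, (∀ k, ContDiff ℝ ∞ (φ k)) ∧
    Tendsto (fun k => eLpNorm (fun x => φ k x - u.toL2 x) 2 (volume.restrict Ω)) atTop (𝓝 0) ∧
    Tendsto (fun k => eLpNorm (fun x => gradient (φ k) x - u.grad x) 2 (volume.restrict Ω))
      atTop (𝓝 0) ∧
    Tendsto (fun k => eLpNorm (fun x => φ k x - w x) 2 (surfaceMeasure Ω)) atTop (𝓝 0)

/-! ### The convex sets and the variational inequalities -/

section Problems

variable {n : ℕ} {Ω : Set (E n)}

/-- `K₊`: the functions in `H¹(Ω)` which are nonnegative in `Ω`. -/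
def Kplus (Ω : Set (E n)) : Set (H1 Ω) :=
  {v | ∀ᵐ x ∂volume.restrict Ω, 0 ≤ v.toL2 x}

/-- `V_h`: the functions that are continuous on the closure of `Ω` and coincide on each element of
the triangulation with a polynomial of degree at most one. -/
def Vh (𝒯 : Triangulation Ω) : Set (H1 Ω) :=
  {v | ∃ f : E n → ℝ, ContinuousOn f (closure Ω) ∧
    (∀ s ∈ 𝒯.cells, ∃ p : E n →ᵃ[ℝ] ℝ, EqOn f p (convexHull ℝ (s : Set (E n)))) ∧
    ∀ᵐ x ∂volume.restrict Ω, v.toL2 x = f x}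

/-- `K₊ₕ`: the nonnegative functions in `V_h`. -/
def Kplush (𝒯 : Triangulation Ω) : Set (H1 Ω) := Vh 𝒯 ∩ Kplus Ω

/-- `u ∈ K` solves on the set `K` the variational inequality
`a_α(u, v - u) ≥ (g, v - u)_H - (q, v - u)_Q + α (b, v - u)_R` for all `v ∈ K`, where
`a_α(u, v) = ∫_Ω ∇u · ∇v + α ∫_Γ₁ u v`, and `Q`, `R` are `L²(Γ₂)`, `L²(Γ₁)`. The functions in the
boundary integrals are traces. -/
def SolvesVI (Γ₁ Γ₂ : Set (E n)) (α b : ℝ) (q : L2Boundary Ω Γ₂) (g : L2 Ω) (K : Set (H1 Ω))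
    (u : H1 Ω) : Prop :=
  u ∈ K ∧ ∃ γu, IsTrace u γu ∧ ∀ v ∈ K, ∀ γv, IsTrace v γv →
    (∫ x in Ω, ⟪u.grad x, (v - u).grad x⟫) +
        α * ∫ x in Γ₁, γu x * (γv x - γu x) ∂surfaceMeasure Ω ≥
      (∫ x in Ω, g x * (v - u).toL2 x) -
        (∫ x in Γ₂, q x * (γv x - γu x) ∂surfaceMeasure Ω) +
        α * ∫ x in Γ₁, b * (γv x - γu x) ∂surfaceMeasure Ω

/-- `u` is the continuous state: the solution of the variational inequality on `K₊`. -/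
def IsContinuousState (Γ₁ Γ₂ : Set (E n)) (α b : ℝ) (q : L2Boundary Ω Γ₂) (g : L2 Ω)
    (u : H1 Ω) : Prop :=
  SolvesVI Γ₁ Γ₂ α b q g (Kplus Ω) u

/-- `u` is the discrete state for the triangulation `𝒯`: the solution of the variational inequality
on `K₊ₕ`. -/
def IsDiscreteState (Γ₁ Γ₂ : Set (E n)) (α b : ℝ) (q : L2Boundary Ω Γ₂) (g : L2 Ω)
    (𝒯 : Triangulation Ω) (u : H1 Ω) : Prop :=
  SolvesVI Γ₁ Γ₂ α b q g (Kplush 𝒯) u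

end Problems

end ObstacleFEM

end

open ObstacleFEM

/-!
The proof follows Falk's argument for the approximation of variational inequalities. Since the
cones satisfy `K₊ₕ ⊆ K₊`, the discrete state is admissible in the continuous inequality, and a
function of `K₊ₕ` close to the continuous state `u` is admissible in the discrete one. Adding the
two inequalities bounds the energy `a_α(uₕ - u, uₕ - u)` by the distance in `V` of `u` to `K₊ₕ`,
measured together with the distance of the traces (`norm_sq_sub_le_of_variational_inequalities`).
It remains to know that `a_α` is coercive, and that the cones `K₊ₕ` fill `K₊` in the limit.

A trace is by definition a limit of the boundary values of smooth functions, so the pairs `(u, w)`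
of a function with its trace form the closure `traceGraph` of a linear graph, and a quadratic
inequality passes from smooth functions to all such pairs.

*Coercivity* is Friedrichs' inequality `IsPolygonalDomain.exists_friedrichs_le`, which needs only
that `Γ₁` has positive surface measure. It follows from two facts on smooth functions. The trace
inequality `IsPolygonalDomain.exists_trace` is proved on each simplex: a facet is covered by
pieces from which segments of a fixed length in the direction of an edge remain in the simplex,
and the one-dimensional trace inequality is integrated over them. Poincaré's inequality
`IsPolygonalDomain.oscBounded`, in the form of a bound of `∬ |φ x - φ y|²`, holds on convex sets
and is carried over the connected set `Ω` along chains of balls. Integrating the trace inequality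
of `φ - φ y` over `y` gives Friedrichs' inequality.

*Approximation.* A function of `K₊` with its trace is a limit of nonnegative smooth functions
(`IsPolygonalDomain.mem_closure_nonneg`): a smooth regularization of the positive part, applied to
an approximating sequence, converges weakly and does not increase the norms of the gradients,
hence converges strongly. A nonnegative smooth function is the limit of its Lagrange interpolants,
which are nonnegative (`IsPolygonalDomain.exists_interpolant_error`); the gradients are controlled
by shape regularity and the uniform continuity of the gradient of the function. The interpolant on
a conforming triangulation is Lipschitz (`Triangulation.exists_interpolant`), and a Lipschitz
function belongs to `H¹(Ω)`, its trace being its restriction, as mollification shows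
(`IsPolygonalDomain.exists_of_lipschitz`).
-/

namespace ObstacleFEM

/-! ### Traces on hyperplane pieces -/

lemma real_enorm_sq (x : ℝ) : ‖x‖ₑ ^ 2 = ENNReal.ofReal (x ^ 2) := by
  rw [Real.enorm_eq_ofReal_abs, ← ENNReal.ofReal_pow (abs_nonneg x), sq_abs]

lemma enorm_sq_eq_ofReal {F : Type*} [NormedAddCommGroup F] (x : F) :
    ‖x‖ₑ ^ 2 = ENNReal.ofReal (‖x‖ ^ 2) := by
  rw [← ofReal_norm, ENNReal.ofReal_pow (norm_nonneg x)]

/-- One-dimensional trace inequality on the interval `[0, δ]`. -/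
lemma enorm_sq_le_lintegral_Icc {f f' : ℝ → ℝ} {δ : ℝ} (hδ : 0 < δ)
    (hf : ∀ t, HasDerivAt f (f' t) t) (hf' : Continuous f') :
    ‖f 0‖ₑ ^ 2 ≤ ENNReal.ofReal (1 / δ + 1) *
      ∫⁻ t in Icc 0 δ, (‖f t‖ₑ ^ 2 + ‖f' t‖ₑ ^ 2) := by
  have hfc : Continuous f := continuous_iff_continuousAt.2 fun t => (hf t).continuousAt
  have e1 : ∫⁻ t in Icc 0 δ, (‖f t‖ₑ ^ 2 + ‖f' t‖ₑ ^ 2) =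
      ENNReal.ofReal (∫ t in Icc 0 δ, (f t ^ 2 + f' t ^ 2)) := by
    rw [ofReal_integral_eq_lintegral_ofReal]
    · refine lintegral_congr fun t => ?_
      rw [real_enorm_sq, real_enorm_sq, ENNReal.ofReal_add (sq_nonneg _) (sq_nonneg _)]
    · exact (Continuous.continuousOn (by fun_prop)).integrableOn_compact isCompact_Icc
    · exact ae_of_all _ fun t => by positivity
  rw [e1, real_enorm_sq, ← ENNReal.ofReal_mul (by positivity)]
  refine ENNReal.ofReal_le_ofReal ?_
  -- the derivative of `(t - δ) * f t ^ 2` is integrated over `[0, δ]`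
  have hd : ∀ t ∈ uIcc 0 δ, HasDerivAt (fun t => (t - δ) * f t ^ 2)
      (f t ^ 2 + (t - δ) * (2 * f t * f' t)) t := by
    intro t _
    have := ((hasDerivAt_id t).sub_const δ).mul ((hf t).pow 2)
    convert! this using 1
    simp
  have hI := intervalIntegral.integral_eq_sub_of_hasDerivAt hd
    (Continuous.intervalIntegrable (by fun_prop) _ _)
  have hle : ∫ t in (0:ℝ)..δ, (f t ^ 2 + (t - δ) * (2 * f t * f' t)) ≤
      ∫ t in (0:ℝ)..δ, (1 + δ) * (f t ^ 2 + f' t ^ 2) := by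
    refine intervalIntegral.integral_mono_on hδ.le (Continuous.intervalIntegrable (by fun_prop) _ _)
      (Continuous.intervalIntegrable (by fun_prop) _ _) fun t ht => ?_
    have h1 : 0 ≤ δ - t := sub_nonneg.2 ht.2
    nlinarith [mul_nonneg h1 (sq_nonneg (f t + f' t)), mul_nonneg ht.1 (sq_nonneg (f t)),
      mul_nonneg ht.1 (sq_nonneg (f' t)), sq_nonneg (f' t)]
  rw [intervalIntegral.integral_const_mul, intervalIntegral.integral_of_le hδ.le,
    intervalIntegral.integral_of_le hδ.le, ← integral_Icc_eq_integral_Ioc,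
    ← integral_Icc_eq_integral_Ioc] at hle
  rw [intervalIntegral.integral_of_le hδ.le, ← integral_Icc_eq_integral_Ioc] at hI
  rw [hI] at hle
  have : f 0 ^ 2 * δ ≤ (1 + δ) * ∫ t in Icc 0 δ, (f t ^ 2 + f' t ^ 2) := by
    simpa [mul_comm] using hle
  rw [← le_div_iff₀ hδ] at this
  refine this.trans_eq ?_
  field_simp

/-- Integration over a hyperplane through the origin and along a transversal direction `e` is, up
to a constant, integration over the whole space. -/
lemma exists_lintegral_slab {n : ℕ} {l : E n →ₗ[ℝ] ℝ} {e : E n} (he : l e ≠ 0) :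
    ∃ C : NNReal, ∀ F : E n → ℝ≥0∞, Measurable F →
      ∫⁻ w : LinearMap.ker l, ∫⁻ t : ℝ, F (w + t • e) = C * ∫⁻ x, F x := by
  have hc : IsCompl (LinearMap.ker l) (Submodule.span ℝ {e}) := by
    constructor
    · rw [Submodule.disjoint_span_singleton]
      intro h
      exact absurd h he
    · rw [codisjoint_iff, eq_top_iff]
      intro x _
      rw [Submodule.mem_sup]
      refine ⟨x - (l x / l e) • e, ?_, (l x / l e) • e,
        Submodule.smul_mem _ _ (Submodule.mem_span_singleton_self e), by simp⟩
      simp [he]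
  have he0 : e ≠ 0 := fun h => he (by simp [h])
  let Φ : (LinearMap.ker l × ℝ) ≃ₗ[ℝ] E n :=
    ((LinearEquiv.refl ℝ (LinearMap.ker l)).prodCongr
      (LinearEquiv.toSpanNonzeroSingleton ℝ (E n) e he0)).trans
      (Submodule.prodEquivOfIsCompl _ _ hc)
  let Ψ := Φ.toContinuousLinearEquiv
  have hΨ : ∀ w : LinearMap.ker l, ∀ t : ℝ, Ψ (w, t) = w + t • e := by
    intro w t
    simp [Ψ, Φ]
  let μ : Measure (LinearMap.ker l × ℝ) := (volume : Measure (LinearMap.ker l)).prod volume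
  have hH : (Measure.map Ψ μ).IsAddHaarMeasure := Ψ.isAddHaarMeasure_map μ
  refine ⟨(Measure.map Ψ μ).addHaarScalarFactor volume, fun F hF => ?_⟩
  have h1 : ∫⁻ x, F x ∂(Measure.map Ψ μ) =
      (Measure.map Ψ μ).addHaarScalarFactor volume * ∫⁻ x, F x := by
    conv_lhs => rw [Measure.isAddLeftInvariant_eq_smul (Measure.map Ψ μ) volume]
    rw [lintegral_smul_measure]
    rfl
  rw [← h1, lintegral_map hF Ψ.continuous.measurable, lintegral_prod]
  · simp only [hΨ]
  · exact (hF.comp Ψ.continuous.measurable).aemeasurable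

/-- Integration over the hyperplane `{l = l x₀}` for the surface measure. -/
lemma setLIntegral_hyperplane {n : ℕ} {l : E n →ₗ[ℝ] ℝ} (hl : l ≠ 0) (x₀ : E n)
    {A : Set (E n)} (hA : MeasurableSet A) (hAl : ∀ x ∈ A, l x = l x₀)
    (F : E n → ℝ≥0∞) (hF : Measurable F) :
    ∫⁻ x in A, F x ∂(Measure.euclideanHausdorffMeasure (n - 1)) =
      ∫⁻ w : LinearMap.ker l, A.indicator F (x₀ + w) := by
  have hfr : Module.finrank ℝ (LinearMap.ker l) = n - 1 := by
    have := Module.Dual.finrank_ker_add_one_of_ne_zero (f := l) hl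
    rw [finrank_euclideanSpace_fin] at this
    omega
  have hiso : Isometry (fun w : LinearMap.ker l => x₀ + (w : E n)) :=
    (IsometryEquiv.addLeft x₀).isometry.comp isometry_subtype_coe
  have hmap := hiso.map_euclideanHausdorffMeasure (d := n - 1)
  have hvol : (Measure.euclideanHausdorffMeasure (n - 1) : Measure (LinearMap.ker l)) = volume := by
    rw [← hfr]
    exact InnerProductSpace.euclideanHausdorffMeasure_eq_volume
  have hsub : A ⊆ range (fun w : LinearMap.ker l => x₀ + (w : E n)) := by
    intro x hx
    refine ⟨⟨x - x₀, ?_⟩, by simp⟩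
    simp [hAl x hx]
  rw [← Measure.restrict_restrict_of_subset hsub, ← hmap, hvol, ← lintegral_indicator hA,
    lintegral_map (hF.indicator hA) hiso.continuous.measurable]

lemma hasDerivAt_comp_line {n : ℕ} {φ : E n → ℝ} (hφ : ContDiff ℝ ∞ φ) (x e : E n) (t : ℝ) :
    HasDerivAt (fun t : ℝ => φ (x + t • e)) ⟪gradient φ (x + t • e), e⟫ t := by
  have h1 : HasFDerivAt φ (fderiv ℝ φ (x + t • e)) (x + t • e) :=
    (hφ.differentiable (by simp)).differentiableAt.hasFDerivAt
  have h2 : HasDerivAt (fun t : ℝ => x + t • e) e t := by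
    simpa using ((hasDerivAt_id t).smul_const e).const_add x
  have := h1.comp_hasDerivAt t h2
  rwa [inner_gradient_left]

/-- Trace inequality on a measurable piece `A` of a hyperplane, when the segments of a fixed
transversal direction and length starting from `A` lie in `D`. -/
lemma exists_trace_slab {n : ℕ} {l : E n →ₗ[ℝ] ℝ} {e : E n} (he : l e ≠ 0) {A D : Set (E n)}
    (hA : MeasurableSet A) (hD : MeasurableSet D) {c : ℝ} (hAl : ∀ x ∈ A, l x = c) {δ : ℝ}
    (hδ : 0 < δ) (hAD : ∀ x ∈ A, ∀ t ∈ Icc 0 δ, x + t • e ∈ D) :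
    ∃ C : NNReal, ∀ φ : E n → ℝ, ContDiff ℝ ∞ φ →
      ∫⁻ x in A, ‖φ x‖ₑ ^ 2 ∂(Measure.euclideanHausdorffMeasure (n - 1)) ≤
        C * ∫⁻ x in D, (‖φ x‖ₑ ^ 2 + ‖gradient φ x‖ₑ ^ 2) := by
  rcases A.eq_empty_or_nonempty with rfl | ⟨x₀, hx₀⟩
  · exact ⟨0, by simp⟩
  obtain ⟨C, hC⟩ := exists_lintegral_slab he
  have hl : l ≠ 0 := fun h => he (by simp [h])
  refine ⟨Real.toNNReal (1 / δ + 1) * (1 + ‖e‖₊ ^ 2) * C, fun φ hφ => ?_⟩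
  have hg : Continuous (gradient φ) := continuous_gradient hφ
  have hφc := hφ.continuous
  set N : E n → ℝ≥0∞ := fun x => ‖φ x‖ₑ ^ 2 + ‖gradient φ x‖ₑ ^ 2 with hN
  have hNm : Measurable N := Continuous.measurable (by fun_prop)
  rw [setLIntegral_hyperplane hl x₀ hA (fun x hx => (hAl x hx).trans (hAl x₀ hx₀).symm) _
    (Continuous.measurable (by fun_prop))]
  have key : ∀ w : LinearMap.ker l, A.indicator (fun x => ‖φ x‖ₑ ^ 2) (x₀ + w) ≤
      ENNReal.ofReal (1 / δ + 1) * (1 + ‖e‖ₑ ^ 2) *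
        ∫⁻ t : ℝ, D.indicator N (x₀ + (w + t • e)) := by
    intro w
    by_cases hw : x₀ + (w : E n) ∈ A
    · rw [indicator_of_mem hw]
      have h1 := enorm_sq_le_lintegral_Icc hδ (hasDerivAt_comp_line hφ (x₀ + w) e)
        (by fun_prop)
      rw [zero_smul, add_zero] at h1
      refine h1.trans ?_
      rw [mul_assoc]
      gcongr
      rw [← lintegral_const_mul', ← lintegral_indicator measurableSet_Icc]
      · refine lintegral_mono fun t => ?_
        by_cases ht : t ∈ Icc 0 δ
        · have := hAD _ hw t ht
          rw [indicator_of_mem ht, ← add_assoc, indicator_of_mem this]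
          have h2 : ‖⟪gradient φ (x₀ + w + t • e), e⟫‖ₑ ^ 2 ≤
              ‖gradient φ (x₀ + w + t • e)‖ₑ ^ 2 * ‖e‖ₑ ^ 2 := by
            rw [← mul_pow]
            gcongr
            simp only [enorm_eq_nnnorm]
            exact_mod_cast nnnorm_inner_le_nnnorm (𝕜 := ℝ) (gradient φ (x₀ + w + t • e)) e
          simp only [hN]
          set a := ‖φ (x₀ + w + t • e)‖ₑ ^ 2
          set b := ‖gradient φ (x₀ + w + t • e)‖ₑ ^ 2
          calc a + ‖⟪gradient φ (x₀ + w + t • e), e⟫‖ₑ ^ 2 ≤ a + b * ‖e‖ₑ ^ 2 := by gcongr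
            _ ≤ (a + b) + (a + b) * ‖e‖ₑ ^ 2 := by gcongr <;> simp
            _ = _ := by ring
        · rw [indicator_of_notMem ht]; exact zero_le
      · simp
    · rw [indicator_of_notMem hw]; exact zero_le
  refine (lintegral_mono key).trans ?_
  rw [lintegral_const_mul', hC (fun x => D.indicator N (x₀ + x))
    ((hNm.indicator hD).comp (measurable_const_add x₀)),
    lintegral_add_left_eq_self (fun x => D.indicator N x) x₀, lintegral_indicator hD]
  · apply le_of_eq
    push_cast
    rw [← mul_assoc]
    rfl
  · finiteness

/-! ### Simplices, polygonal domains and the trace inequality -/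

lemma isCompact_convexHull_finset {n : ℕ} (s : Finset (E n)) :
    IsCompact (convexHull ℝ (s : Set (E n))) :=
  s.finite_toSet.isCompact_convexHull ℝ

/-- The vertices of a nondegenerate `n`-simplex, as an affine basis. -/
noncomputable def simplexBasis {n : ℕ} {s : Finset (E n)} (hcard : s.card = n + 1)
    (hs : AffineIndependent ℝ ((↑) : s → E n)) : AffineBasis s ℝ (E n) :=
  ⟨(↑), hs, by
    rw [hs.affineSpan_eq_top_iff_card_eq_finrank_add_one, finrank_euclideanSpace_fin]
    simpa using hcard⟩

section Simplex

variable {n : ℕ} {s : Finset (E n)} (hcard : s.card = n + 1)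
  (hs : AffineIndependent ℝ ((↑) : s → E n))

@[simp] lemma simplexBasis_apply (p : s) : simplexBasis hcard hs p = p := rfl

lemma range_simplexBasis : range (simplexBasis hcard hs) = (s : Set (E n)) := by
  ext x; simp

include hcard hs

lemma convexHull_simplex_eq :
    convexHull ℝ (s : Set (E n)) = {x | ∀ p, 0 ≤ (simplexBasis hcard hs).coord p x} := by
  rw [← range_simplexBasis hcard hs, AffineBasis.convexHull_eq_nonneg_coord]

lemma interior_simplex_eq :
    interior (convexHull ℝ (s : Set (E n))) =
      {x | ∀ p, 0 < (simplexBasis hcard hs).coord p x} := by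
  rw [← range_simplexBasis hcard hs, AffineBasis.interior_convexHull]

lemma interior_simplex_nonempty : (interior (convexHull ℝ (s : Set (E n)))).Nonempty := by
  rw [← range_simplexBasis hcard hs]
  exact ⟨_, (simplexBasis hcard hs).centroid_mem_interior_convexHull⟩

lemma coord_add_smul_sub (p p' i : s) (x : E n) (t : ℝ) :
    (simplexBasis hcard hs).coord i (x + t • ((p : E n) - p')) =
      (simplexBasis hcard hs).coord i x +
        t * ((if i = p then 1 else 0) - if i = p' then 1 else 0) := by
  classical
  have h1 : (simplexBasis hcard hs).coord i (p : E n) = if i = p then 1 else 0 :=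
    (simplexBasis hcard hs).coord_apply i p
  have h2 : (simplexBasis hcard hs).coord i (p' : E n) = if i = p' then 1 else 0 :=
    (simplexBasis hcard hs).coord_apply i p'
  have h3 : ((simplexBasis hcard hs).coord i).linear ((p : E n) - p') =
      (if i = p then 1 else 0) - if i = p' then 1 else 0 := by
    have := ((simplexBasis hcard hs).coord i).linearMap_vsub (p : E n) (p' : E n)
    simp only [vsub_eq_sub, h1, h2] at this
    exact this
  have h4 := ((simplexBasis hcard hs).coord i).map_vadd x (t • ((p : E n) - p'))
  simp only [vadd_eq_add, map_smul, h3, smul_eq_mul] at h4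
  rw [add_comm, h4, add_comm]

/-- The part of the facet opposite to `p` where the barycentric coordinate of `p'` is the largest
up to a factor. The segments from its points in the direction `p - p'` enter the simplex. -/
lemma exists_trace_facet_piece (p p' : s) (hpp : p ≠ p') :
    ∃ C : NNReal, ∀ φ : E n → ℝ, ContDiff ℝ ∞ φ →
      ∫⁻ x in {x | x ∈ convexHull ℝ (s : Set (E n)) ∧ (simplexBasis hcard hs).coord p x = 0 ∧
          1 / ((n : ℝ) + 1) ≤ (simplexBasis hcard hs).coord p' x},
          ‖φ x‖ₑ ^ 2 ∂(Measure.euclideanHausdorffMeasure (n - 1)) ≤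
        C * ∫⁻ x in convexHull ℝ (s : Set (E n)), (‖φ x‖ₑ ^ 2 + ‖gradient φ x‖ₑ ^ 2) := by
  set b := simplexBasis hcard hs with hb
  have hc : ∀ i, Continuous (b.coord i) := fun i => AffineMap.continuous_of_finiteDimensional _
  have hT : IsClosed (convexHull ℝ (s : Set (E n))) :=
    (isCompact_convexHull_finset s).isClosed
  have hlin : ∀ x, (b.coord p).linear x = b.coord p x - b.coord p 0 := by
    intro x
    have := (b.coord p).linearMap_vsub x 0
    simpa using this
  refine exists_trace_slab (l := (b.coord p).linear) (e := (p : E n) - p') (c := - b.coord p 0)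
    (δ := 1 / ((n : ℝ) + 1)) ?_ ?_ hT.measurableSet ?_ (by positivity) ?_
  · have := (b.coord p).linearMap_vsub (p : E n) (p' : E n)
    have h1 : b.coord p (p : E n) = 1 := b.coord_apply_eq p
    have h2 : b.coord p (p' : E n) = 0 := b.coord_apply_ne hpp
    simp only [vsub_eq_sub] at this
    rw [this, h1, h2]
    norm_num
  · refine (hT.inter (IsClosed.inter (isClosed_eq (hc p) continuous_const)
      (isClosed_le continuous_const (hc p')))).measurableSet
  · rintro x ⟨-, hx, -⟩
    rw [hlin, hx, zero_sub]
  · rintro x ⟨hx, hxp, hxp'⟩ t ht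
    rw [convexHull_simplex_eq hcard hs, mem_ofPred_eq] at hx ⊢
    intro i
    rw [coord_add_smul_sub]
    have hi := hx i
    rw [← hb] at hi ⊢
    by_cases h1 : i = p
    · subst h1
      simp [hpp, hxp, ht.1]
    · by_cases h2 : i = p'
      · subst h2
        simp only [h1, if_true, if_false]
        linarith [ht.2]
      · simpa [h1, h2] using hi

/-- The trace inequality on a simplex. On each facet some other barycentric coordinate is at least
`1 / (n + 1)`, so that finitely many pieces cover the boundary. -/
lemma exists_trace_simplex :
    ∃ C : NNReal, ∀ φ : E n → ℝ, ContDiff ℝ ∞ φ →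
      ∫⁻ x in frontier (convexHull ℝ (s : Set (E n))),
          ‖φ x‖ₑ ^ 2 ∂(Measure.euclideanHausdorffMeasure (n - 1)) ≤
        C * ∫⁻ x in convexHull ℝ (s : Set (E n)), (‖φ x‖ₑ ^ 2 + ‖gradient φ x‖ₑ ^ 2) := by
  have hpiece : ∀ q : {q : s × s // q.1 ≠ q.2}, _ :=
    fun q => exists_trace_facet_piece hcard hs q.1.1 q.1.2 q.2
  choose C hC using hpiece
  have hT : IsClosed (convexHull ℝ (s : Set (E n))) :=
    (isCompact_convexHull_finset s).isClosed
  refine ⟨∑ q, C q, fun φ hφ => ?_⟩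
  have hcov : frontier (convexHull ℝ (s : Set (E n))) ⊆ ⋃ q : {q : s × s // q.1 ≠ q.2},
      {x | x ∈ convexHull ℝ (s : Set (E n)) ∧ (simplexBasis hcard hs).coord q.1.1 x = 0 ∧
          1 / ((n : ℝ) + 1) ≤ (simplexBasis hcard hs).coord q.1.2 x} := by
    intro x hx
    rw [hT.frontier_eq, Set.mem_sdiff, interior_simplex_eq hcard hs] at hx
    obtain ⟨hxT, hx2⟩ := hx
    have hxT' := hxT
    rw [convexHull_simplex_eq hcard hs] at hxT'
    simp only [mem_ofPred_eq, not_forall, not_lt] at hx2 hxT'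
    obtain ⟨p, hp⟩ := hx2
    have hp0 := le_antisymm hp (hxT' p)
    -- the barycentric coordinates add up to `1`, so that one of them is at least the mean value
    obtain ⟨p', hp'⟩ : ∃ p', 1 / ((n : ℝ) + 1) ≤ (simplexBasis hcard hs).coord p' x := by
      by_contra! h
      have h1 := (simplexBasis hcard hs).sum_coord_apply_eq_one x
      have h2 : ∑ i, (simplexBasis hcard hs).coord i x < ∑ _i : s, 1 / ((n : ℝ) + 1) :=
        Finset.sum_lt_sum_of_nonempty ⟨p, Finset.mem_univ _⟩ fun i _ => h i
      rw [h1, Finset.sum_const, Finset.card_univ, Fintype.card_coe, hcard] at h2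
      simp only [nsmul_eq_mul] at h2
      push_cast at h2
      rw [mul_one_div_cancel (by positivity)] at h2
      exact lt_irrefl _ h2
    refine mem_iUnion.2 ⟨⟨(p, p'), ?_⟩, hxT, hp0, hp'⟩
    rintro (rfl : p = p')
    rw [hp0] at hp'
    exact absurd hp' (not_le.2 (by positivity))
  calc _ ≤ _ := lintegral_mono_set hcov
    _ ≤ _ := lintegral_iUnion_le _ _
    _ = ∑ q, _ := tsum_fintype _
    _ ≤ ∑ q, (C q * ∫⁻ x in convexHull ℝ (s : Set (E n)), (‖φ x‖ₑ ^ 2 + ‖gradient φ x‖ₑ ^ 2)) :=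
      Finset.sum_le_sum fun q _ => hC q φ hφ
    _ = _ := by rw [← Finset.sum_mul]; push_cast; rfl

end Simplex

section Domain

variable {n : ℕ} {Ω : Set (E n)}

/-- Since `Ω` is the interior of its closure, its boundary lies on the boundaries of the simplices:
an interior point of one of them is interior to the closure. -/
lemma IsPolygonalDomain.frontier_subset {S : Finset (Finset (E n))} (hΩ : IsPolygonalDomain Ω)
    (hS : closure Ω = ⋃ s ∈ S, convexHull ℝ (s : Set (E n))) :
    frontier Ω ⊆ ⋃ s ∈ S, frontier (convexHull ℝ (s : Set (E n))) := by
  intro x hx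
  have hx1 := hx.1
  rw [hS] at hx1
  simp only [mem_iUnion, exists_prop] at hx1 ⊢
  obtain ⟨s, hs, hxs⟩ := hx1
  refine ⟨s, hs, subset_closure hxs, fun hxi => hx.2 ?_⟩
  rw [hΩ.isOpen.interior_eq, ← hΩ.interior_closure, hS]
  exact interior_mono (subset_biUnion_of_mem hs) hxi

lemma IsPolygonalDomain.volume_frontier (hΩ : IsPolygonalDomain Ω) : volume (frontier Ω) = 0 := by
  obtain ⟨S, -, hS⟩ := hΩ.exists_simplices
  refine measure_mono_null (hΩ.frontier_subset hS) ?_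
  refine (measure_biUnion_null_iff S.countable_toSet).2 fun s _ => ?_
  exact (convex_convexHull ℝ _).addHaar_frontier volume

lemma IsPolygonalDomain.restrict_closure (hΩ : IsPolygonalDomain Ω) :
    (volume : Measure (E n)).restrict (closure Ω) = volume.restrict Ω := by
  refine Measure.restrict_congr_set ?_
  rw [ae_eq_set]
  refine ⟨measure_mono_null ?_ hΩ.volume_frontier, by simp [sdiff_eq_empty.2 subset_closure]⟩
  rw [frontier, hΩ.isOpen.interior_eq]

lemma IsPolygonalDomain.isCompact_closure (hΩ : IsPolygonalDomain Ω) : IsCompact (closure Ω) := by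
  obtain ⟨S, -, hS⟩ := hΩ.exists_simplices
  rw [hS]
  exact S.isCompact_biUnion fun s _ => isCompact_convexHull_finset s

lemma IsPolygonalDomain.volume_lt_top (hΩ : IsPolygonalDomain Ω) : volume Ω < ⊤ :=
  (measure_mono subset_closure).trans_lt hΩ.isCompact_closure.measure_lt_top

/-- The trace inequality, for smooth functions. -/
lemma IsPolygonalDomain.exists_trace (hΩ : IsPolygonalDomain Ω) :
    ∃ C : NNReal, ∀ φ : E n → ℝ, ContDiff ℝ ∞ φ →
      ∫⁻ x, ‖φ x‖ₑ ^ 2 ∂surfaceMeasure Ω ≤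
        C * ∫⁻ x in Ω, (‖φ x‖ₑ ^ 2 + ‖gradient φ x‖ₑ ^ 2) := by
  obtain ⟨S, hS1, hS⟩ := hΩ.exists_simplices
  have h : ∀ s : S, _ := fun s => exists_trace_simplex (hS1 s s.2).1 (hS1 s s.2).2
  choose C hC using h
  refine ⟨∑ s, C s, fun φ hφ => ?_⟩
  have hsub : frontier Ω ⊆ ⋃ s : S, frontier (convexHull ℝ ((s : Finset (E n)) : Set (E n))) := by
    refine (hΩ.frontier_subset hS).trans ?_
    simp only [iUnion_subset_iff]
    intro s hs
    exact subset_iUnion_of_subset ⟨s, hs⟩ subset_rfl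
  have hle : ∀ s : S, ∫⁻ x in convexHull ℝ ((s : Finset (E n)) : Set (E n)),
      (‖φ x‖ₑ ^ 2 + ‖gradient φ x‖ₑ ^ 2) ≤
        ∫⁻ x in Ω, (‖φ x‖ₑ ^ 2 + ‖gradient φ x‖ₑ ^ 2) := by
    intro s
    rw [← hΩ.restrict_closure, hS]
    exact lintegral_mono_set
      (subset_biUnion_of_mem (u := fun s : Finset (E n) => convexHull ℝ (s : Set (E n))) s.2)
  calc _ ≤ _ := lintegral_mono_set hsub
    _ ≤ _ := lintegral_iUnion_le _ _
    _ = ∑ s, _ := tsum_fintype _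
    _ ≤ ∑ s, (C s * ∫⁻ x in Ω, (‖φ x‖ₑ ^ 2 + ‖gradient φ x‖ₑ ^ 2)) :=
      Finset.sum_le_sum fun s _ => (hC s φ hφ).trans (mul_le_mul_right (hle s) _)
    _ = _ := by rw [← Finset.sum_mul]; push_cast; rfl

lemma gradient_one {x : E n} : gradient (fun _ : E n => (1 : ℝ)) x = 0 := by
  simp [gradient]

/-- The trace inequality, applied to the constant `1`, shows that the boundary has finite surface
measure. -/
lemma IsPolygonalDomain.isFiniteMeasure_surfaceMeasure (hΩ : IsPolygonalDomain Ω) :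
    IsFiniteMeasure (surfaceMeasure Ω) := by
  obtain ⟨C, hC⟩ := hΩ.exists_trace
  have := hC (fun _ => 1) contDiff_const
  simp only [gradient_one, enorm_one, one_pow, lintegral_one, enorm_zero, ne_eq,
    OfNat.ofNat_ne_zero, not_false_eq_true, zero_pow, add_zero, Measure.restrict_apply_univ] at this
  exact ⟨this.trans_lt (ENNReal.mul_lt_top ENNReal.coe_lt_top hΩ.volume_lt_top)⟩

end Domain

/-! ### Poincaré's inequality for overlapping sets -/

section Poincare

variable {n : ℕ}

lemma sq_add_le_enorm (a b : ℝ) : ‖a + b‖ₑ ^ 2 ≤ 2 * ‖a‖ₑ ^ 2 + 2 * ‖b‖ₑ ^ 2 := by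
  rw [real_enorm_sq, real_enorm_sq, real_enorm_sq, ← ENNReal.ofReal_ofNat,
    ← ENNReal.ofReal_mul (by norm_num), ← ENNReal.ofReal_mul (by norm_num),
    ← ENNReal.ofReal_add (by positivity) (by positivity)]
  exact ENNReal.ofReal_le_ofReal (by nlinarith [sq_nonneg (a - b)])

/-- The values of smooth functions on `A` and on `B` differ, in quadratic mean, by at most a
constant times the Dirichlet integral over `Ω`. -/
def OscBounded (Ω A B : Set (E n)) : Prop :=
  ∃ C : NNReal, ∀ φ : E n → ℝ, ContDiff ℝ ∞ φ →
    ∫⁻ x in A, ∫⁻ y in B, ‖φ x - φ y‖ₑ ^ 2 ≤ C * ∫⁻ x in Ω, ‖gradient φ x‖ₑ ^ 2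

/-- The difference of two values, by integration of the derivative along the segment joining the
points and the Cauchy-Schwarz inequality. -/
lemma enorm_sub_sq_le {φ : E n → ℝ} (hφ : ContDiff ℝ ∞ φ) (x y : E n) :
    ‖φ x - φ y‖ₑ ^ 2 ≤ ‖x - y‖ₑ ^ 2 *
      ∫⁻ t in Icc (0:ℝ) 1, ‖gradient φ (y + t • (x - y))‖ₑ ^ 2 := by
  have hg : Continuous (gradient φ) := continuous_gradient hφ
  have h1 : ‖x - y‖ₑ ^ 2 * ∫⁻ t in Icc (0:ℝ) 1, ‖gradient φ (y + t • (x - y))‖ₑ ^ 2 =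
      ENNReal.ofReal (∫ t in Icc (0:ℝ) 1, ‖x - y‖ ^ 2 * ‖gradient φ (y + t • (x - y))‖ ^ 2) := by
    rw [ofReal_integral_eq_lintegral_ofReal, ← lintegral_const_mul']
    · refine lintegral_congr fun t => ?_
      rw [enorm_sq_eq_ofReal, enorm_sq_eq_ofReal, ENNReal.ofReal_mul (by positivity)]
    · finiteness
    · exact (Continuous.continuousOn (by fun_prop)).integrableOn_compact isCompact_Icc
    · exact ae_of_all _ fun t => by positivity
  rw [h1, real_enorm_sq]
  refine ENNReal.ofReal_le_ofReal ?_
  set h : ℝ → ℝ := fun t => ⟪gradient φ (y + t • (x - y)), x - y⟫ with hh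
  have hc : Continuous h := by fun_prop
  have hI := intervalIntegral.integral_eq_sub_of_hasDerivAt (a := 0) (b := 1)
    (fun t _ => hasDerivAt_comp_line hφ y (x - y) t) (hc.intervalIntegrable _ _)
  simp only [one_smul, add_sub_cancel, zero_smul, add_zero] at hI
  set m := φ x - φ y
  -- Jensen's inequality: the integral of `(h - m) ^ 2` is nonnegative
  have hJ : 0 ≤ ∫ t in (0:ℝ)..1, (h t - m) ^ 2 :=
    intervalIntegral.integral_nonneg zero_le_one fun t _ => sq_nonneg _
  have e : ∀ t, (h t - m) ^ 2 = h t ^ 2 - 2 * m * h t + m ^ 2 := fun t => by ring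
  simp only [e] at hJ
  rw [intervalIntegral.integral_add (Continuous.intervalIntegrable (by fun_prop) _ _)
    (Continuous.intervalIntegrable (by fun_prop) _ _),
    intervalIntegral.integral_sub (Continuous.intervalIntegrable (by fun_prop) _ _)
    (Continuous.intervalIntegrable (by fun_prop) _ _), intervalIntegral.integral_const_mul, hI,
    intervalIntegral.integral_const] at hJ
  simp only [sub_zero, one_smul] at hJ
  have hle : ∫ t in (0:ℝ)..1, h t ^ 2 ≤
      ∫ t in (0:ℝ)..1, ‖x - y‖ ^ 2 * ‖gradient φ (y + t • (x - y))‖ ^ 2 := by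
    refine intervalIntegral.integral_mono_on zero_le_one
      (Continuous.intervalIntegrable (by fun_prop) _ _)
      (Continuous.intervalIntegrable (by fun_prop) _ _) fun t _ => ?_
    rw [← mul_pow, mul_comm]
    exact sq_le_sq' (neg_le_of_abs_le (abs_real_inner_le_norm _ _)) (real_inner_le_norm _ _)
  rw [intervalIntegral.integral_of_le zero_le_one, intervalIntegral.integral_of_le zero_le_one,
    ← integral_Icc_eq_integral_Ioc, ← integral_Icc_eq_integral_Ioc] at hle
  rw [intervalIntegral.integral_of_le zero_le_one, ← integral_Icc_eq_integral_Ioc] at hJ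
  nlinarith

lemma lintegral_comp_add_smul_le (G : E n → ℝ≥0∞) (hG : Measurable G) (z : E n) {t : ℝ}
    (ht : 1 / 2 ≤ t) : ∫⁻ x, G (z + t • x) ≤ 2 ^ n * ∫⁻ x, G x := by
  have ht0 : t ≠ 0 := by linarith
  have h1 : ∫⁻ x, G (z + t • x) = ∫⁻ x, G (z + x) ∂(Measure.map (t • ·) volume) := by
    rw [lintegral_map (f := fun x => G (z + x)) (hG.comp (measurable_const_add z))
      (measurable_const_smul t)]
  rw [h1, Measure.map_addHaar_smul volume ht0, lintegral_smul_measure,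
    lintegral_add_left_eq_self G z, finrank_euclideanSpace_fin, smul_eq_mul]
  gcongr
  rw [abs_of_nonneg (by positivity), ← inv_pow]
  have : t⁻¹ ≤ 2 := by
    rw [inv_le_comm₀ (by linarith) (by norm_num)]
    linarith
  calc ENNReal.ofReal (t⁻¹ ^ n) ≤ ENNReal.ofReal (2 ^ n) := by
        apply ENNReal.ofReal_le_ofReal
        gcongr
    _ = 2 ^ n := by rw [ENNReal.ofReal_pow (by norm_num), ENNReal.ofReal_ofNat]

/-- Poincaré's inequality on a bounded convex set, by integration along the segments joining its
points. The set enters `Ω` only through integrals, so that it may contain boundary points of `Ω`. -/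
lemma OscBounded.of_convex {Ω A : Set (E n)} (hA : Convex ℝ A) (hAm : MeasurableSet A)
    (hAb : Bornology.IsBounded A)
    (hAΩ : ∀ F : E n → ℝ≥0∞, ∫⁻ x in A, F x ≤ ∫⁻ x in Ω, F x) : OscBounded Ω A A := by
  have hfin : volume A ≠ ⊤ := hAb.measure_lt_top.ne
  obtain ⟨d, hd⟩ := hAb.subset_closedBall 0
  have hd' : ∀ x ∈ A, ‖x‖ ≤ d := fun x hx => by simpa using hd hx
  refine ⟨Real.toNNReal (2 * d) ^ 2 * ((volume A).toNNReal * 2 ^ n), fun φ hφ => ?_⟩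
  have hg : Continuous (gradient φ) := continuous_gradient hφ
  set G : E n → ℝ≥0∞ := fun x => ‖gradient φ x‖ₑ ^ 2 with hG
  have hGc : Continuous G := by fun_prop
  have hslice : ∀ t ∈ Icc (0:ℝ) 1, ∫⁻ x in A, ∫⁻ y in A, G (y + t • (x - y)) ≤
      volume A * 2 ^ n * ∫⁻ x in A, G x := by
    -- the variable whose coefficient in the convex combination is at least `1 / 2` is integrated
    -- first
    have main : ∀ t ∈ Icc (0:ℝ) 1, 1 / 2 ≤ t → ∫⁻ y in A, ∫⁻ x in A, G (y + t • (x - y)) ≤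
        volume A * 2 ^ n * ∫⁻ x in A, G x := by
      intro t ht ht2
      have : ∀ y ∈ A, ∫⁻ x in A, G (y + t • (x - y)) ≤ 2 ^ n * ∫⁻ x in A, G x := by
        intro y hy
        calc ∫⁻ x in A, G (y + t • (x - y))
            ≤ ∫⁻ x in A, A.indicator G ((1 - t) • y + t • x) := by
              refine setLIntegral_mono' hAm fun x hx => ?_
              have e : y + t • (x - y) = (1 - t) • y + t • x := by module
              rw [e, indicator_of_mem]
              exact hA hy hx (sub_nonneg.2 ht.2) ht.1 (by ring)
          _ ≤ ∫⁻ x, A.indicator G ((1 - t) • y + t • x) := setLIntegral_le_lintegral _ _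
          _ ≤ 2 ^ n * ∫⁻ x, A.indicator G x :=
              lintegral_comp_add_smul_le _ (hGc.measurable.indicator hAm) _ ht2
          _ = _ := by rw [lintegral_indicator hAm]
      calc _ ≤ ∫⁻ y in A, 2 ^ n * ∫⁻ x in A, G x := setLIntegral_mono' hAm this
        _ = _ := by rw [setLIntegral_const]; ring
    intro t ht
    rcases le_total (1 / 2) t with h | h
    · rw [lintegral_lintegral_swap (Continuous.measurable (by fun_prop)).aemeasurable]
      exact main t ht h
    · have := main (1 - t) ⟨by linarith [ht.2], by linarith [ht.1]⟩ (by linarith)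
      refine le_trans (le_of_eq ?_) this
      refine lintegral_congr fun x => lintegral_congr fun y => ?_
      congr 1
      module
  calc ∫⁻ x in A, ∫⁻ y in A, ‖φ x - φ y‖ₑ ^ 2
      ≤ ∫⁻ x in A, ∫⁻ y in A, ENNReal.ofReal (2 * d) ^ 2 *
          ∫⁻ t in Icc (0:ℝ) 1, G (y + t • (x - y)) := by
        refine setLIntegral_mono' hAm fun x hx => setLIntegral_mono' hAm fun y hy => ?_
        refine (enorm_sub_sq_le hφ x y).trans ?_
        gcongr
        rw [← ofReal_norm]
        apply ENNReal.ofReal_le_ofReal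
        linarith [norm_sub_le x y, hd' x hx, hd' y hy]
    _ = ENNReal.ofReal (2 * d) ^ 2 *
          ∫⁻ t in Icc (0:ℝ) 1, ∫⁻ x in A, ∫⁻ y in A, G (y + t • (x - y)) := by
        have hm : Measurable fun p : (E n × E n) × ℝ => G (p.1.2 + p.2 • (p.1.1 - p.1.2)) :=
          Continuous.measurable (by fun_prop)
        simp_rw [lintegral_const_mul' _ _ (show ENNReal.ofReal (2 * d) ^ 2 ≠ ⊤ by finiteness)]
        congr 1
        have e1 : ∀ x, ∫⁻ y in A, ∫⁻ t in Icc (0:ℝ) 1, G (y + t • (x - y)) =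
            ∫⁻ t in Icc (0:ℝ) 1, ∫⁻ y in A, G (y + t • (x - y)) := fun x =>
          lintegral_lintegral_swap (Continuous.measurable (by fun_prop)).aemeasurable
        simp_rw [e1]
        rw [lintegral_lintegral_swap]
        refine Measurable.aemeasurable ?_
        refine Measurable.lintegral_prod_right' (f := fun p : (E n × ℝ) × E n =>
          G (p.2 + p.1.2 • (p.1.1 - p.2))) ?_
        exact Continuous.measurable (by fun_prop)
    _ ≤ ENNReal.ofReal (2 * d) ^ 2 *
          ∫⁻ t in Icc (0:ℝ) 1, volume A * 2 ^ n * ∫⁻ x in A, G x := by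
        gcongr 1
        exact setLIntegral_mono' measurableSet_Icc hslice
    _ = ENNReal.ofReal (2 * d) ^ 2 * (volume A * 2 ^ n * ∫⁻ x in A, G x) := by simp
    _ ≤ ENNReal.ofReal (2 * d) ^ 2 * (volume A * 2 ^ n * ∫⁻ x in Ω, G x) := by
        gcongr 2
        exact hAΩ G
    _ = _ := by
        push_cast
        rw [ENNReal.coe_toNNReal hfin, ENNReal.ofReal]
        ring

lemma OscBounded.mono {Ω A B A' B' : Set (E n)} (h : OscBounded Ω A B) (hA : A' ⊆ A)
    (hB : B' ⊆ B) : OscBounded Ω A' B' := by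
  obtain ⟨C, hC⟩ := h
  exact ⟨C, fun φ hφ => ((lintegral_mono fun x => lintegral_mono_set hB).trans
    (lintegral_mono_set hA)).trans (hC φ hφ)⟩

lemma OscBounded.symm {Ω A B : Set (E n)} (h : OscBounded Ω A B) : OscBounded Ω B A := by
  obtain ⟨C, hC⟩ := h
  refine ⟨C, fun φ hφ => ?_⟩
  have := hφ.continuous
  rw [lintegral_lintegral_swap (Continuous.measurable (by fun_prop)).aemeasurable]
  refine le_trans (le_of_eq ?_) (hC φ hφ)
  exact lintegral_congr fun x => lintegral_congr fun y => by rw [← enorm_neg, neg_sub]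

/-- The intermediate values on `M`, which has positive volume, link those on `A` and on `B`. -/
lemma OscBounded.trans {Ω A M B : Set (E n)} (h1 : OscBounded Ω A M) (h2 : OscBounded Ω M B)
    (hM : volume M ≠ 0) (hM' : volume M ≠ ⊤) (hA : volume A ≠ ⊤) (hB : volume B ≠ ⊤) :
    OscBounded Ω A B := by
  obtain ⟨C₁, hC₁⟩ := h1
  obtain ⟨C₂, hC₂⟩ := h2
  refine ⟨(volume M).toNNReal⁻¹ * (2 * (volume B).toNNReal * C₁ + 2 * (volume A).toNNReal * C₂),
    fun φ hφ => ?_⟩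
  have := hφ.continuous
  set D := ∫⁻ x in Ω, ‖gradient φ x‖ₑ ^ 2
  have key : volume M * ∫⁻ x in A, ∫⁻ y in B, ‖φ x - φ y‖ₑ ^ 2 ≤
      2 * volume B * (C₁ * D) + 2 * volume A * (C₂ * D) := by
    calc volume M * ∫⁻ x in A, ∫⁻ y in B, ‖φ x - φ y‖ₑ ^ 2
        = ∫⁻ x in A, ∫⁻ z in M, ∫⁻ y in B, ‖φ x - φ y‖ₑ ^ 2 := by
          rw [← lintegral_const_mul' _ _ hM']
          refine lintegral_congr fun x => ?_
          rw [setLIntegral_const, mul_comm]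
      _ ≤ ∫⁻ x in A, ∫⁻ z in M, ∫⁻ y in B, (2 * ‖φ x - φ z‖ₑ ^ 2 + 2 * ‖φ z - φ y‖ₑ ^ 2) := by
          refine lintegral_mono fun x => lintegral_mono fun z => lintegral_mono fun y => ?_
          have := sq_add_le_enorm (φ x - φ z) (φ z - φ y)
          rwa [sub_add_sub_cancel] at this
      _ = ∫⁻ x in A, ∫⁻ z in M, (2 * volume B * ‖φ x - φ z‖ₑ ^ 2 +
            2 * ∫⁻ y in B, ‖φ z - φ y‖ₑ ^ 2) := by
          refine lintegral_congr fun x => lintegral_congr fun z => ?_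
          rw [lintegral_add_left measurable_const, setLIntegral_const,
            lintegral_const_mul' _ _ (by simp)]
          ring
      _ = ∫⁻ x in A, (2 * volume B * (∫⁻ z in M, ‖φ x - φ z‖ₑ ^ 2) +
            2 * ∫⁻ z in M, ∫⁻ y in B, ‖φ z - φ y‖ₑ ^ 2) := by
          refine lintegral_congr fun x => ?_
          rw [lintegral_add_left (Measurable.const_mul (Continuous.measurable (by fun_prop)) _),
            lintegral_const_mul' _ _ (by finiteness), lintegral_const_mul' _ _ (by simp)]
      _ = 2 * volume B * (∫⁻ x in A, ∫⁻ z in M, ‖φ x - φ z‖ₑ ^ 2) +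
            2 * volume A * ∫⁻ z in M, ∫⁻ y in B, ‖φ z - φ y‖ₑ ^ 2 := by
          rw [lintegral_add_right _ measurable_const,
            lintegral_const_mul' _ _ (by finiteness), setLIntegral_const]
          ring
      _ ≤ _ := by
          gcongr
          · exact hC₁ φ hφ
          · exact hC₂ φ hφ
  rw [mul_comm, ← ENNReal.le_div_iff_mul_le (Or.inl hM) (Or.inl hM')] at key
  refine key.trans_eq ?_
  rw [ENNReal.div_eq_inv_mul]
  push_cast
  rw [ENNReal.coe_inv (by simp [ENNReal.toNNReal_eq_zero_iff, hM, hM']),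
    ENNReal.coe_toNNReal hM', ENNReal.coe_toNNReal hA, ENNReal.coe_toNNReal hB]
  ring

end Poincare

/-! ### Friedrichs' inequality -/

section Friedrichs

variable {n : ℕ} {Ω : Set (E n)}

lemma OscBounded.ball {x : E n} {r : ℝ} (h : Metric.ball x r ⊆ Ω) :
    OscBounded Ω (Metric.ball x r) (Metric.ball x r) :=
  .of_convex (convex_ball x r) measurableSet_ball Metric.isBounded_ball
    fun _ => lintegral_mono_set h

/-- Small balls around any two points of a connected open set are linked by a chain of
overlapping balls. -/
lemma exists_oscBounded_ball (ho : IsOpen Ω) (hc : IsPreconnected Ω) {x y : E n} (hx : x ∈ Ω)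
    (hy : y ∈ Ω) : ∃ r > 0, OscBounded Ω (Metric.ball x r) (Metric.ball y r) := by
  refine hc.induction₂ (fun x y => ∃ r > 0, OscBounded Ω (Metric.ball x r) (Metric.ball y r))
    ?_ ?_ ?_ hx hy
  · intro x hx
    obtain ⟨ρ, hρ, hb⟩ := Metric.isOpen_iff.1 ho x hx
    filter_upwards [mem_nhdsWithin_of_mem_nhds (Metric.ball_mem_nhds x (half_pos hρ))] with y hy
    refine ⟨ρ / 2, half_pos hρ, (OscBounded.ball hb).mono
      (Metric.ball_subset_ball (by linarith)) (Metric.ball_subset_ball' ?_)⟩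
    rw [Metric.mem_ball] at hy
    linarith
  · rintro x y z - - - ⟨r, hr, h⟩ ⟨r', hr', h'⟩
    refine ⟨min r r', lt_min hr hr', OscBounded.trans (M := Metric.ball y (min r r'))
      (h.mono (Metric.ball_subset_ball (min_le_left _ _))
        (Metric.ball_subset_ball (min_le_left _ _)))
      (h'.mono (Metric.ball_subset_ball (min_le_right _ _))
        (Metric.ball_subset_ball (min_le_right _ _)))
      (Metric.measure_ball_pos volume y (lt_min hr hr')).ne' measure_ball_lt_top.ne
      measure_ball_lt_top.ne measure_ball_lt_top.ne⟩
  · rintro x y - - ⟨r, hr, h⟩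
    exact ⟨r, hr, h.symm⟩

lemma OscBounded.iUnion {ι κ : Type*} [Fintype ι] [Fintype κ] {A : ι → Set (E n)}
    {B : κ → Set (E n)} (h : ∀ i j, OscBounded Ω (A i) (B j)) :
    OscBounded Ω (⋃ i, A i) (⋃ j, B j) := by
  choose C hC using h
  refine ⟨∑ i, ∑ j, C i j, fun φ hφ => ?_⟩
  have := hφ.continuous
  calc ∫⁻ x in ⋃ i, A i, ∫⁻ y in ⋃ j, B j, ‖φ x - φ y‖ₑ ^ 2
      ≤ ∑ i, ∫⁻ x in A i, ∫⁻ y in ⋃ j, B j, ‖φ x - φ y‖ₑ ^ 2 := by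
        rw [← tsum_fintype (L := .unconditional _)]
        exact lintegral_iUnion_le _ _
    _ ≤ ∑ i, ∫⁻ x in A i, ∑ j, ∫⁻ y in B j, ‖φ x - φ y‖ₑ ^ 2 := by
        gcongr with i _ x
        rw [← tsum_fintype (L := .unconditional _)]
        exact lintegral_iUnion_le _ _
    _ = ∑ i, ∑ j, ∫⁻ x in A i, ∫⁻ y in B j, ‖φ x - φ y‖ₑ ^ 2 := by
        refine Finset.sum_congr rfl fun i _ => lintegral_finsetSum _ fun j _ => ?_
        exact Measurable.lintegral_prod_right' (f := fun p : E n × E n => ‖φ p.1 - φ p.2‖ₑ ^ 2)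
          (Continuous.measurable (by fun_prop))
    _ ≤ ∑ i, ∑ j, C i j * ∫⁻ x in Ω, ‖gradient φ x‖ₑ ^ 2 := by
        gcongr with i _ j _
        exact hC i j φ hφ
    _ = _ := by
        simp_rw [← Finset.sum_mul]
        push_cast
        rfl

lemma IsPolygonalDomain.interior_simplex_subset (hΩ : IsPolygonalDomain Ω)
    {S : Finset (Finset (E n))} (hS : closure Ω = ⋃ s ∈ S, convexHull ℝ (s : Set (E n)))
    {s : Finset (E n)} (hs : s ∈ S) : interior (convexHull ℝ (s : Set (E n))) ⊆ Ω := by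
  rw [← hΩ.interior_closure, hS]
  exact interior_mono
    (subset_biUnion_of_mem (u := fun s : Finset (E n) => convexHull ℝ (s : Set (E n))) hs)

/-- Poincaré's inequality on the whole domain. -/
lemma IsPolygonalDomain.oscBounded (hΩ : IsPolygonalDomain Ω) : OscBounded Ω Ω Ω := by
  obtain ⟨S, hS1, hS⟩ := hΩ.exists_simplices
  have hT : ∀ s ∈ S,
      OscBounded Ω (convexHull ℝ (s : Set (E n))) (convexHull ℝ (s : Set (E n))) := by
    intro s hs
    refine .of_convex (convex_convexHull ℝ _) (isCompact_convexHull_finset s).measurableSet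
      (isCompact_convexHull_finset s).isBounded fun F => ?_
    rw [← hΩ.restrict_closure, hS]
    exact lintegral_mono_set
      (subset_biUnion_of_mem (u := fun s : Finset (E n) => convexHull ℝ (s : Set (E n))) hs)
  have hfin : ∀ s : Finset (E n), volume (convexHull ℝ (s : Set (E n))) ≠ ⊤ := fun s =>
    (isCompact_convexHull_finset s).measure_lt_top.ne
  have hst : ∀ s ∈ S, ∀ t ∈ S,
      OscBounded Ω (convexHull ℝ (s : Set (E n))) (convexHull ℝ (t : Set (E n))) := by
    intro s hs t ht
    obtain ⟨x, hx⟩ := interior_simplex_nonempty (hS1 s hs).1 (hS1 s hs).2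
    obtain ⟨y, hy⟩ := interior_simplex_nonempty (hS1 t ht).1 (hS1 t ht).2
    obtain ⟨r, hr, h⟩ := exists_oscBounded_ball hΩ.isOpen hΩ.isConnected.isPreconnected
      (hΩ.interior_simplex_subset hS hs hx) (hΩ.interior_simplex_subset hS ht hy)
    obtain ⟨r₁, hr₁, hb₁⟩ := Metric.isOpen_iff.1 isOpen_interior x hx
    obtain ⟨r₂, hr₂, hb₂⟩ := Metric.isOpen_iff.1 isOpen_interior y hy
    have hpos : 0 < min r (min r₁ r₂) := by positivity
    have h1 : OscBounded Ω (convexHull ℝ (s : Set (E n))) (Metric.ball x (min r (min r₁ r₂))) :=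
      (hT s hs).mono subset_rfl ((Metric.ball_subset_ball (by simp)).trans
        (hb₁.trans interior_subset))
    have h2 : OscBounded Ω (Metric.ball x (min r (min r₁ r₂)))
        (Metric.ball y (min r (min r₁ r₂))) :=
      h.mono (Metric.ball_subset_ball (by simp)) (Metric.ball_subset_ball (by simp))
    have h3 : OscBounded Ω (Metric.ball y (min r (min r₁ r₂))) (convexHull ℝ (t : Set (E n))) :=
      (hT t ht).mono ((Metric.ball_subset_ball (by simp)).trans
        (hb₂.trans interior_subset)) subset_rfl
    exact (h1.trans h2 (Metric.measure_ball_pos volume x hpos).ne' measure_ball_lt_top.ne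
      (hfin s) measure_ball_lt_top.ne).trans h3 (Metric.measure_ball_pos volume y hpos).ne'
      measure_ball_lt_top.ne (hfin s) (hfin t)
  have hU := OscBounded.iUnion (ι := S) (κ := S) (Ω := Ω)
    (A := fun s => convexHull ℝ ((s : Finset (E n)) : Set (E n)))
    (B := fun s => convexHull ℝ ((s : Finset (E n)) : Set (E n)))
    fun s t => hst s s.2 t t.2
  have hsub : Ω ⊆ ⋃ s : S, convexHull ℝ ((s : Finset (E n)) : Set (E n)) := by
    refine subset_closure.trans ?_
    rw [hS]
    simp only [iUnion_subset_iff]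
    exact fun s hs => subset_iUnion_of_subset ⟨s, hs⟩ subset_rfl
  exact hU.mono hsub hsub

lemma gradient_sub_const {φ : E n → ℝ} (c : ℝ) (x : E n) :
    gradient (fun y => φ y - c) x = gradient φ x := by
  simp [gradient, fderiv_sub_const]

/-- Friedrichs' inequality, for smooth functions. It follows from the trace inequality for
`φ - φ y`, integrated over `y ∈ Ω`. -/
lemma IsPolygonalDomain.exists_friedrichs (hΩ : IsPolygonalDomain Ω) {Γ : Set (E n)}
    (hpos : 0 < surfaceMeasure Ω Γ) :
    ∃ C : NNReal, ∀ φ : E n → ℝ, ContDiff ℝ ∞ φ →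
      ∫⁻ x in Ω, ‖φ x‖ₑ ^ 2 ≤ C * ((∫⁻ x in Ω, ‖gradient φ x‖ₑ ^ 2) +
        ∫⁻ x in Γ, ‖φ x‖ₑ ^ 2 ∂surfaceMeasure Ω) := by
  obtain ⟨C₁, hC₁⟩ := hΩ.exists_trace
  obtain ⟨C₂, hC₂⟩ := hΩ.oscBounded
  have := hΩ.isFiniteMeasure_surfaceMeasure
  have hV := hΩ.volume_lt_top.ne
  set m := surfaceMeasure Ω Γ with hm
  have hm' : m ≠ ⊤ := measure_ne_top _ _
  refine ⟨m.toNNReal⁻¹ * (2 * (volume Ω).toNNReal + 2 * C₁ * (C₂ + (volume Ω).toNNReal)),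
    fun φ hφ => ?_⟩
  have hφc := hφ.continuous
  set D := ∫⁻ x in Ω, ‖gradient φ x‖ₑ ^ 2
  set R := ∫⁻ x in Γ, ‖φ x‖ₑ ^ 2 ∂surfaceMeasure Ω
  have hy : ∀ y, m * ‖φ y‖ₑ ^ 2 ≤ 2 * R + 2 * (C₁ * ((∫⁻ x in Ω, ‖φ x - φ y‖ₑ ^ 2) + D)) := by
    intro y
    have h1 := hC₁ (fun x => φ x - φ y) (hφ.sub contDiff_const)
    simp only [gradient_sub_const] at h1
    rw [lintegral_add_left (Continuous.measurable (by fun_prop))] at h1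
    calc m * ‖φ y‖ₑ ^ 2 = ∫⁻ x in Γ, ‖φ y‖ₑ ^ 2 ∂surfaceMeasure Ω := by
          rw [setLIntegral_const, mul_comm]
      _ ≤ ∫⁻ x in Γ, (2 * ‖φ x‖ₑ ^ 2 + 2 * ‖φ x - φ y‖ₑ ^ 2) ∂surfaceMeasure Ω := by
          refine lintegral_mono fun x => ?_
          have := sq_add_le_enorm (φ x) (-(φ x - φ y))
          rw [enorm_neg] at this
          simpa using this
      _ = 2 * R + 2 * ∫⁻ x in Γ, ‖φ x - φ y‖ₑ ^ 2 ∂surfaceMeasure Ω := by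
          rw [lintegral_add_left (Measurable.const_mul (Continuous.measurable (by fun_prop)) _),
            lintegral_const_mul' _ _ (by simp), lintegral_const_mul' _ _ (by simp)]
      _ ≤ _ := by
          gcongr
          exact (setLIntegral_le_lintegral _ _).trans h1
  have key : m * ∫⁻ y in Ω, ‖φ y‖ₑ ^ 2 ≤
      2 * R * volume Ω + 2 * (C₁ * (C₂ * D + D * volume Ω)) := by
    calc m * ∫⁻ y in Ω, ‖φ y‖ₑ ^ 2 = ∫⁻ y in Ω, m * ‖φ y‖ₑ ^ 2 := by
          rw [lintegral_const_mul' _ _ hm']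
      _ ≤ ∫⁻ y in Ω, (2 * R + 2 * (C₁ * ((∫⁻ x in Ω, ‖φ x - φ y‖ₑ ^ 2) + D))) :=
          lintegral_mono hy
      _ = 2 * R * volume Ω +
            2 * (C₁ * ((∫⁻ y in Ω, ∫⁻ x in Ω, ‖φ x - φ y‖ₑ ^ 2) + D * volume Ω)) := by
          rw [lintegral_add_left measurable_const, setLIntegral_const,
            lintegral_const_mul' _ _ (by simp), lintegral_const_mul' _ _ (by simp),
            lintegral_add_right _ measurable_const, setLIntegral_const]
      _ ≤ _ := by
          rw [lintegral_lintegral_swap (Continuous.measurable (by fun_prop)).aemeasurable]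
          gcongr
          exact hC₂ φ hφ
  rw [mul_comm, ← ENNReal.le_div_iff_mul_le (Or.inl hpos.ne') (Or.inl hm')] at key
  refine key.trans ?_
  rw [ENNReal.div_eq_inv_mul]
  push_cast
  rw [ENNReal.coe_inv (by simp [ENNReal.toNNReal_eq_zero_iff, hpos.ne', hm']),
    ENNReal.coe_toNNReal hm', ENNReal.coe_toNNReal hV]
  suffices h : 2 * R * volume Ω + 2 * (C₁ * (C₂ * D + D * volume Ω)) ≤
      (2 * volume Ω + 2 * C₁ * (C₂ + volume Ω)) * (D + R) from
    (mul_le_mul_right h _).trans_eq (mul_assoc _ _ _).symm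
  calc 2 * R * volume Ω + 2 * (C₁ * (C₂ * D + D * volume Ω))
      = (2 * volume Ω) * R + 2 * C₁ * (C₂ + volume Ω) * D := by ring
    _ ≤ (2 * volume Ω) * (D + R) + 2 * C₁ * (C₂ + volume Ω) * (D + R) := by
        gcongr <;> simp
    _ = _ := by ring

end Friedrichs

/-! ### Weak gradients and weak convergence -/

section WeakGradients

variable {n : ℕ} {Ω : Set (E n)}

lemma memLp_test_gradient {η : E n → ℝ} (hη : ContDiff ℝ ∞ η) (hc : HasCompactSupport η)
    (v : E n) : MemLp (fun x => ⟪gradient η x, v⟫) 2 (volume.restrict Ω) :=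
  Continuous.memLp_of_hasCompactSupport ((continuous_gradient hη).inner continuous_const)
    ((hasCompactSupport_gradient hc).comp_left (g := fun y : E n => ⟪y, v⟫) (inner_zero_left _))

lemma memLp_test_smul {η : E n → ℝ} (hη : ContDiff ℝ ∞ η) (hc : HasCompactSupport η)
    (v : E n) : MemLp (fun x => η x • v) 2 (volume.restrict Ω) :=
  Continuous.memLp_of_hasCompactSupport (hη.continuous.smul continuous_const) (hc.smul_right)

lemma inner_toLp_test_smul {η : E n → ℝ} (hη : ContDiff ℝ ∞ η) (hc : HasCompactSupport η)
    (v : E n) (G : L2Vec Ω) :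
    ⟪(memLp_test_smul hη hc v).toLp (μ := volume.restrict Ω), G⟫ = ⟪v, ∫ x in Ω, η x • G x⟫ := by
  rw [← integral_inner (integrable_smul_field G hη hc), L2.inner_def]
  refine integral_congr_ae ?_
  filter_upwards [(memLp_test_smul hη hc v).coeFn_toLp (μ := volume.restrict Ω)] with x hx
  rw [hx, real_inner_smul_left, real_inner_smul_right]

lemma inner_toLp_test_gradient {η : E n → ℝ} (hη : ContDiff ℝ ∞ η) (hc : HasCompactSupport η)
    (v : E n) (u : L2 Ω) :
    ⟪(memLp_test_gradient hη hc v).toLp (μ := volume.restrict Ω), u⟫ =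
      ⟪v, ∫ x in Ω, u x • gradient η x⟫ := by
  rw [← integral_inner (integrable_smul_gradient u hη hc), L2.inner_def]
  refine integral_congr_ae ?_
  filter_upwards [(memLp_test_gradient hη hc v).coeFn_toLp (μ := volume.restrict Ω)] with x hx
  rw [hx, real_inner_smul_right, real_inner_comm (gradient η x)]
  simp

/-- The weak gradient relation, tested with the vector fields `η • v` and expressed by inner
products of `L²`. -/
lemma isWeakGradient_iff (u : L2 Ω) (G : L2Vec Ω) :
    IsWeakGradient Ω u G ↔ ∀ (η : E n → ℝ) (hη : ContDiff ℝ ∞ η) (hc : HasCompactSupport η),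
      tsupport η ⊆ Ω → ∀ v : E n,
        ⟪(memLp_test_gradient hη hc v).toLp (μ := volume.restrict Ω), u⟫ =
          -⟪(memLp_test_smul hη hc v).toLp (μ := volume.restrict Ω), G⟫ := by
  constructor
  · intro h η hη hc hs v
    rw [inner_toLp_test_smul hη hc, inner_toLp_test_gradient hη hc, h η hη hc hs, inner_neg_right]
  · intro h η hη hc hs
    refine ext_inner_left ℝ fun v => ?_
    have := h η hη hc hs v
    rwa [inner_toLp_test_smul hη hc, inner_toLp_test_gradient hη hc, ← inner_neg_right] at this

/-- The weak gradient is a closed operator. -/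
lemma isClosed_sobolevH1 : IsClosed (sobolevH1 Ω : Set (WithLp 2 (L2 Ω × L2Vec Ω))) := by
  have : (sobolevH1 Ω : Set (WithLp 2 (L2 Ω × L2Vec Ω))) =
      {p | ∀ (η : E n → ℝ) (hη : ContDiff ℝ ∞ η) (hc : HasCompactSupport η),
      tsupport η ⊆ Ω → ∀ v : E n,
        ⟪(memLp_test_gradient hη hc v).toLp (μ := volume.restrict Ω), p.fst⟫ =
          -⟪(memLp_test_smul hη hc v).toLp (μ := volume.restrict Ω), p.snd⟫} := by
    ext p
    exact isWeakGradient_iff p.fst p.snd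
  rw [this]
  simp only [ofPred_forall]
  refine isClosed_iInter fun η => isClosed_iInter fun hη => isClosed_iInter fun hc =>
    isClosed_iInter fun _ => isClosed_iInter fun v => isClosed_eq ?_ ?_
  · exact continuous_const.inner (WithLp.fstL 2 ℝ (L2 Ω) (L2Vec Ω)).continuous
  · exact (continuous_const.inner (WithLp.sndL 2 ℝ (L2 Ω) (L2Vec Ω)).continuous).neg

/-- The span of the test vector fields is dense in the square integrable vector fields. -/
lemma dense_span_test (ho : IsOpen Ω) :
    (Submodule.span ℝ {G : L2Vec Ω | ∃ (η : E n → ℝ) (hη : ContDiff ℝ ∞ η)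
      (hc : HasCompactSupport η) (_ : tsupport η ⊆ Ω) (v : E n),
      G = (memLp_test_smul hη hc v).toLp}).topologicalClosure = ⊤ := by
  rw [Submodule.topologicalClosure_eq_top_iff, Submodule.eq_bot_iff]
  intro G hG
  rw [Submodule.mem_orthogonal] at hG
  have h0 : ∀ᵐ x ∂volume, x ∈ Ω → (G : E n → E n) x = 0 := by
    refine ho.ae_eq_zero_of_integral_contDiff_smul_eq_zero ?_ fun η hη hc hs => ?_
    · exact locallyIntegrableOn_of_locallyIntegrable_restrict
        ((Lp.memLp G).locallyIntegrable (by norm_num))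
    · refine ext_inner_left ℝ fun v => ?_
      rw [inner_zero_right, ← hG _ (Submodule.subset_span ⟨η, hη, hc, hs, v, rfl⟩),
        inner_toLp_test_smul hη hc, setIntegral_eq_integral_of_forall_compl_eq_zero]
      intro x hx
      rw [image_eq_zero_of_notMem_tsupport fun h => hx (hs h), zero_smul]
  rw [Lp.eq_zero_iff_ae_eq_zero]
  exact (ae_restrict_iff' ho.measurableSet).2 h0

/-- The weak gradient as a continuous linear map. -/
noncomputable def gradL (Ω : Set (E n)) : H1 Ω →L[ℝ] L2Vec Ω :=
  (WithLp.sndL 2 ℝ (L2 Ω) (L2Vec Ω)).comp (sobolevH1 Ω).subtypeL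

/-- The embedding of `H¹(Ω)` into `L²(Ω)` as a continuous linear map. -/
noncomputable def toL2L (Ω : Set (E n)) : H1 Ω →L[ℝ] L2 Ω :=
  (WithLp.fstL 2 ℝ (L2 Ω) (L2Vec Ω)).comp (sobolevH1 Ω).subtypeL

@[simp] lemma gradL_apply (u : H1 Ω) : gradL Ω u = u.grad := rfl

@[simp] lemma toL2L_apply (u : H1 Ω) : toL2L Ω u = u.toL2 := rfl

lemma H1.norm_sq (u : H1 Ω) : ‖u‖ ^ 2 = ‖u.toL2‖ ^ 2 + ‖u.grad‖ ^ 2 :=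
  WithLp.prod_norm_sq_eq_of_L2 u.1

/-- A sequence which is bounded in `H¹(Ω)` and converges to `0` in `L²(Ω)` converges weakly to `0`
in `H¹(Ω)`. -/
lemma tendsto_inner_grad (ho : IsOpen Ω) {w : ℕ → H1 Ω} {M : ℝ} (hM : ∀ k, ‖(w k).grad‖ ≤ M)
    (hw : Tendsto (fun k => (w k).toL2) atTop (𝓝 0)) (G : L2Vec Ω) :
    Tendsto (fun k => ⟪G, (w k).grad⟫) atTop (𝓝 0) := by
  set K := Submodule.span ℝ {G : L2Vec Ω | ∃ (η : E n → ℝ) (hη : ContDiff ℝ ∞ η)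
      (hc : HasCompactSupport η) (_ : tsupport η ⊆ Ω) (v : E n),
      G = (memLp_test_smul hη hc v).toLp} with hK
  have hspan : ∀ G ∈ K, Tendsto (fun k => ⟪G, (w k).grad⟫) atTop (𝓝 0) := by
    intro G hG
    induction hG using Submodule.span_induction with
    | mem G h =>
      obtain ⟨η, hη, hc, hs, v, rfl⟩ := h
      have h1 : ∀ k, ⟪(memLp_test_smul hη hc v).toLp (μ := volume.restrict Ω), (w k).grad⟫ =
          -⟪(memLp_test_gradient hη hc v).toLp (μ := volume.restrict Ω), (w k).toL2⟫ := by
        intro k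
        have := (isWeakGradient_iff _ _).1 (w k).2 η hη hc hs v
        exact (neg_eq_iff_eq_neg.2 this).symm
      simp_rw [h1]
      have := ((tendsto_const_nhds (x := (memLp_test_gradient hη hc v).toLp
        (μ := volume.restrict Ω))).inner hw (𝕜 := ℝ)).neg
      simpa using this
    | zero => simp
    | add x y _ _ hx hy => simpa [inner_add_left] using hx.add hy
    | smul a x _ hx => simpa [real_inner_smul_left] using hx.const_mul a
  have hM0 : 0 ≤ M := (norm_nonneg _).trans (hM 0)
  rw [Metric.tendsto_atTop]
  intro ε hε
  have hG : G ∈ closure (K : Set (L2Vec Ω)) := by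
    rw [← Submodule.topologicalClosure_coe, dense_span_test ho]
    trivial
  obtain ⟨G', hG', hd⟩ := Metric.mem_closure_iff.1 hG (ε / (2 * (M + 1))) (by positivity)
  obtain ⟨N, hN⟩ := Metric.tendsto_atTop.1 (hspan G' hG') (ε / 2) (by positivity)
  refine ⟨N, fun k hk => ?_⟩
  have h1 := hN k hk
  rw [Real.dist_eq, sub_zero] at h1 ⊢
  have h2 : ⟪G, (w k).grad⟫ = ⟪G - G', (w k).grad⟫ + ⟪G', (w k).grad⟫ := by
    rw [inner_sub_left]; ring
  have h3 : |⟪G - G', (w k).grad⟫| ≤ ε / (2 * (M + 1)) * M := by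
    refine (abs_real_inner_le_norm _ _).trans ?_
    rw [dist_eq_norm] at hd
    exact mul_le_mul hd.le (hM k) (norm_nonneg _) (by positivity)
  have h4 : ε / (2 * (M + 1)) * M ≤ ε / 2 := by
    rw [div_mul_eq_mul_div, div_le_div_iff₀ (by positivity) (by norm_num)]
    nlinarith
  rw [h2]
  exact (abs_add_le _ _).trans_lt (by linarith)

end WeakGradients

/-! ### Smooth functions and the trace relation -/

section Smooth

variable {n : ℕ} {Ω : Set (E n)}

/-- The space of smooth functions on `ℝⁿ`. -/
def smoothFn (n : ℕ) : Submodule ℝ (E n → ℝ) where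
  carrier := {φ | ContDiff ℝ ∞ φ}
  zero_mem' := (contDiff_const : ContDiff ℝ ∞ fun _ : E n => (0 : ℝ))
  add_mem' {φ ψ} (h1 : ContDiff ℝ ∞ φ) (h2 : ContDiff ℝ ∞ ψ) := (h1.add h2 : ContDiff ℝ ∞ (φ + ψ))
  smul_mem' c φ (h : ContDiff ℝ ∞ φ) := (h.const_smul c : ContDiff ℝ ∞ (c • φ))

lemma contDiff_smoothFn (φ : smoothFn n) : ContDiff ℝ ∞ (φ : E n → ℝ) :=
  show (φ : E n → ℝ) ∈ {φ : E n → ℝ | ContDiff ℝ ∞ φ} from φ.2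

lemma continuous_smoothFn (φ : smoothFn n) : Continuous (φ : E n → ℝ) :=
  (contDiff_smoothFn φ).continuous

lemma continuous_gradient_smoothFn (φ : smoothFn n) : Continuous (gradient (φ : E n → ℝ)) :=
  continuous_gradient (contDiff_smoothFn φ)

lemma differentiableAt_smoothFn (φ : smoothFn n) (x : E n) :
    DifferentiableAt ℝ (φ : E n → ℝ) x :=
  ((contDiff_smoothFn φ).differentiable (by simp)).differentiableAt

lemma gradient_smoothFn_add (φ ψ : smoothFn n) :
    gradient ((φ + ψ : smoothFn n) : E n → ℝ) =
      gradient (φ : E n → ℝ) + gradient (ψ : E n → ℝ) := by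
  ext1 x
  simp only [gradient, Submodule.coe_add, Pi.add_apply]
  rw [fderiv_add (differentiableAt_smoothFn φ x) (differentiableAt_smoothFn ψ x), map_add]

lemma gradient_smoothFn_smul (c : ℝ) (φ : smoothFn n) :
    gradient ((c • φ : smoothFn n) : E n → ℝ) = c • gradient (φ : E n → ℝ) := by
  ext1 x
  simp only [gradient, Submodule.coe_smul, Pi.smul_apply]
  rw [fderiv_const_smul (differentiableAt_smoothFn φ x), map_smulₛₗ]
  simp

lemma memLp_of_continuous_of_ae_mem {F : Type*} [NormedAddCommGroup F] {μ : Measure (E n)}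
    [IsFiniteMeasure μ] {K : Set (E n)} (hK : IsCompact K) (hμ : ∀ᵐ x ∂μ, x ∈ K) {f : E n → F}
    (hf : Continuous f) : MemLp f 2 μ := by
  obtain ⟨C, hC⟩ := hK.exists_bound_of_continuousOn hf.continuousOn
  exact MemLp.of_bound hf.aestronglyMeasurable C (hμ.mono hC)

lemma IsPolygonalDomain.isFiniteMeasure_restrict (hΩ : IsPolygonalDomain Ω) :
    IsFiniteMeasure ((volume : Measure (E n)).restrict Ω) :=
  ⟨by simpa using hΩ.volume_lt_top⟩

lemma IsPolygonalDomain.memLp_of_continuous (hΩ : IsPolygonalDomain Ω) {F : Type*}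
    [NormedAddCommGroup F] {f : E n → F} (hf : Continuous f) :
    MemLp f 2 (volume.restrict Ω) := by
  have := hΩ.isFiniteMeasure_restrict
  refine memLp_of_continuous_of_ae_mem hΩ.isCompact_closure ?_ hf
  filter_upwards [ae_restrict_mem hΩ.isOpen.measurableSet] with x hx using subset_closure hx

lemma IsPolygonalDomain.memLp_surfaceMeasure (hΩ : IsPolygonalDomain Ω) {f : E n → ℝ}
    (hf : Continuous f) : MemLp f 2 (surfaceMeasure Ω) := by
  have := hΩ.isFiniteMeasure_surfaceMeasure
  refine memLp_of_continuous_of_ae_mem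
    (hΩ.isCompact_closure.of_isClosed_subset isClosed_frontier frontier_subset_closure) ?_ hf
  exact ae_restrict_mem isClosed_frontier.measurableSet

lemma integral_smul_gradient {φ η : E n → ℝ} (hφ : ContDiff ℝ ∞ φ) (hη : ContDiff ℝ ∞ η)
    (hc : HasCompactSupport η) : ∫ x, φ x • gradient η x = -∫ x, η x • gradient φ x := by
  have hφc := hφ.continuous
  have hηc := hη.continuous
  have hgφ := continuous_gradient hφ
  have hgη := continuous_gradient hη
  have i1 : Integrable (fun x => φ x • gradient η x) :=
    Continuous.integrable_of_hasCompactSupport (by fun_prop)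
      ((hasCompactSupport_gradient hc).smul_left (f := φ))
  have i2 : Integrable (fun x => η x • gradient φ x) :=
    Continuous.integrable_of_hasCompactSupport (by fun_prop) hc.smul_right
  have i3 : Integrable (fun x => φ x * η x) :=
    Continuous.integrable_of_hasCompactSupport (by fun_prop) hc.mul_left
  refine ext_inner_left ℝ fun v => ?_
  rw [inner_neg_right, ← integral_inner i1, ← integral_inner i2]
  simp_rw [real_inner_smul_right, real_inner_comm _ v, inner_gradient_left]
  have := integral_mul_fderiv_eq_neg_fderiv_mul_of_integrable (μ := volume) (f := φ) (g := η)
    (v := v) ?_ ?_ i3 (fun x _ => (hφ.differentiable (by simp)).differentiableAt)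
    (fun x _ => (hη.differentiable (by simp)).differentiableAt)
  · rw [this]
    simp_rw [mul_comm]
  · have := i2.inner_const (𝕜 := ℝ) v
    refine this.congr (ae_of_all _ fun x => ?_)
    simp only [real_inner_smul_left, inner_gradient_left]
    ring
  · have := i1.inner_const (𝕜 := ℝ) v
    refine this.congr (ae_of_all _ fun x => ?_)
    simp only [real_inner_smul_left, inner_gradient_left]

lemma isWeakGradient_smooth {φ : E n → ℝ} (hφ : ContDiff ℝ ∞ φ)
    (h1 : MemLp φ 2 (volume.restrict Ω)) (h2 : MemLp (gradient φ) 2 (volume.restrict Ω)) :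
    IsWeakGradient Ω (h1.toLp φ) (h2.toLp (gradient φ)) := by
  intro η hη hc hs
  have e1 : ∫ x in Ω, (h1.toLp φ) x • gradient η x = ∫ x in Ω, φ x • gradient η x := by
    refine integral_congr_ae ?_
    filter_upwards [h1.coeFn_toLp] with x hx
    rw [hx]
  have e2 : ∫ x in Ω, η x • (h2.toLp (gradient φ)) x = ∫ x in Ω, η x • gradient φ x := by
    refine integral_congr_ae ?_
    filter_upwards [h2.coeFn_toLp] with x hx
    rw [hx]
  have hsg : tsupport (gradient η) ⊆ tsupport η := by
    refine closure_minimal (fun x hx => ?_) (isClosed_tsupport η)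
    refine support_fderiv_subset ℝ fun h => hx ?_
    simp [gradient, h]
  rw [e1, e2, setIntegral_eq_integral_of_forall_compl_eq_zero,
    setIntegral_eq_integral_of_forall_compl_eq_zero, integral_smul_gradient hφ hη hc]
  · intro x hx
    rw [image_eq_zero_of_notMem_tsupport fun h => hx (hs h), zero_smul]
  · intro x hx
    rw [image_eq_zero_of_notMem_tsupport fun h => hx (hs (hsg h)), smul_zero]

lemma toLp_mem_sobolevH1 {φ : E n → ℝ} (hφ : ContDiff ℝ ∞ φ)
    (h1 : MemLp φ 2 (volume.restrict Ω)) (h2 : MemLp (gradient φ) 2 (volume.restrict Ω)) :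
    WithLp.toLp 2 (h1.toLp φ, h2.toLp (gradient φ)) ∈ sobolevH1 Ω :=
  isWeakGradient_smooth hφ h1 h2

/-- The restriction of smooth functions to `Ω`, as elements of `L²(Ω)`. -/
noncomputable def IsPolygonalDomain.valueL2 (hΩ : IsPolygonalDomain Ω) :
    smoothFn n →ₗ[ℝ] L2 Ω where
  toFun φ := (hΩ.memLp_of_continuous (continuous_smoothFn φ)).toLp φ
  map_add' _ _ := rfl
  map_smul' _ _ := rfl

/-- The classical gradient of smooth functions, as an element of `L²(Ω; ℝⁿ)`. -/
noncomputable def IsPolygonalDomain.gradL2 (hΩ : IsPolygonalDomain Ω) :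
    smoothFn n →ₗ[ℝ] L2Vec Ω where
  toFun φ := (hΩ.memLp_of_continuous (continuous_gradient_smoothFn φ)).toLp (gradient (φ : E n → ℝ))
  map_add' φ ψ := by
    rw [← MemLp.toLp_add]
    exact MemLp.toLp_congr _ _ (by rw [gradient_smoothFn_add])
  map_smul' c φ := by
    rw [RingHom.id_apply, ← MemLp.toLp_const_smul]
    exact MemLp.toLp_congr _ _ (by rw [gradient_smoothFn_smul])

/-- The restriction of smooth functions to `Ω`, as elements of `H¹(Ω)`. -/
noncomputable def IsPolygonalDomain.ofSmooth (hΩ : IsPolygonalDomain Ω) :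
    smoothFn n →ₗ[ℝ] H1 Ω :=
  ((WithLp.linearEquiv 2 ℝ (L2 Ω × L2Vec Ω)).symm.toLinearMap ∘ₗ
    (hΩ.valueL2.prod hΩ.gradL2)).codRestrict (sobolevH1 Ω) fun φ =>
      toLp_mem_sobolevH1 (contDiff_smoothFn φ) (hΩ.memLp_of_continuous (continuous_smoothFn φ))
        (hΩ.memLp_of_continuous (continuous_gradient_smoothFn φ))

/-- The restriction of smooth functions to the boundary. -/
noncomputable def IsPolygonalDomain.boundaryValue (hΩ : IsPolygonalDomain Ω) :
    smoothFn n →ₗ[ℝ] Lp ℝ 2 (surfaceMeasure Ω) where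
  toFun φ := (hΩ.memLp_surfaceMeasure (continuous_smoothFn φ)).toLp φ
  map_add' _ _ := rfl
  map_smul' _ _ := rfl

variable (hΩ : IsPolygonalDomain Ω)
include hΩ

lemma IsPolygonalDomain.coeFn_ofSmooth (φ : smoothFn n) :
    (hΩ.ofSmooth φ).toL2 =ᵐ[volume.restrict Ω] (φ : E n → ℝ) :=
  (hΩ.memLp_of_continuous (continuous_smoothFn φ)).coeFn_toLp

lemma IsPolygonalDomain.coeFn_grad_ofSmooth (φ : smoothFn n) :
    (hΩ.ofSmooth φ).grad =ᵐ[volume.restrict Ω] gradient (φ : E n → ℝ) :=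
  (hΩ.memLp_of_continuous (continuous_gradient_smoothFn φ)).coeFn_toLp

lemma IsPolygonalDomain.coeFn_boundaryValue (φ : smoothFn n) :
    hΩ.boundaryValue φ =ᵐ[surfaceMeasure Ω] (φ : E n → ℝ) :=
  (hΩ.memLp_surfaceMeasure (continuous_smoothFn φ)).coeFn_toLp

omit hΩ in
lemma tendsto_H1_iff {ι : Type*} {l : Filter ι} {v : ι → H1 Ω} {u : H1 Ω} :
    Tendsto v l (𝓝 u) ↔ Tendsto (fun i => (v i).toL2) l (𝓝 u.toL2) ∧
      Tendsto (fun i => (v i).grad) l (𝓝 u.grad) := by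
  refine ⟨fun h =>
      ⟨((toL2L Ω).continuous.tendsto u).comp h, ((gradL Ω).continuous.tendsto u).comp h⟩,
    fun h => ?_⟩
  rw [tendsto_subtype_rng]
  exact ((WithLp.prod_continuous_toLp 2 (L2 Ω) (L2Vec Ω)).tendsto _).comp
    (h.1.prodMk_nhds h.2)

/-- The trace relation is the closure of the graph of the restriction to the boundary of smooth
functions. -/
noncomputable def IsPolygonalDomain.traceGraph :
    Submodule ℝ (H1 Ω × Lp ℝ 2 (surfaceMeasure Ω)) :=
  (LinearMap.range (hΩ.ofSmooth.prod hΩ.boundaryValue)).topologicalClosure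

lemma IsPolygonalDomain.isTrace_iff {u : H1 Ω} {w : Lp ℝ 2 (surfaceMeasure Ω)} :
    IsTrace u w ↔ (u, w) ∈ hΩ.traceGraph := by
  have key : ∀ φ : ℕ → smoothFn n,
      Tendsto (fun k => (hΩ.ofSmooth (φ k), hΩ.boundaryValue (φ k))) atTop (𝓝 (u, w)) ↔
      Tendsto (fun k => eLpNorm (fun x => (φ k : E n → ℝ) x - u.toL2 x) 2 (volume.restrict Ω))
        atTop (𝓝 0) ∧
      Tendsto (fun k => eLpNorm (fun x => gradient (φ k : E n → ℝ) x - u.grad x) 2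
        (volume.restrict Ω)) atTop (𝓝 0) ∧
      Tendsto (fun k => eLpNorm (fun x => (φ k : E n → ℝ) x - w x) 2 (surfaceMeasure Ω))
        atTop (𝓝 0) := by
    intro φ
    rw [Prod.tendsto_iff, tendsto_H1_iff, and_assoc, Lp.tendsto_Lp_iff_tendsto_eLpNorm',
      Lp.tendsto_Lp_iff_tendsto_eLpNorm', Lp.tendsto_Lp_iff_tendsto_eLpNorm']
    refine and_congr (tendsto_congr fun k => eLpNorm_congr_ae ?_)
      (and_congr (tendsto_congr fun k => eLpNorm_congr_ae ?_)
      (tendsto_congr fun k => eLpNorm_congr_ae ?_))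
    · filter_upwards [hΩ.coeFn_ofSmooth (φ k)] with x hx
      rw [Pi.sub_apply, hx]
    · filter_upwards [hΩ.coeFn_grad_ofSmooth (φ k)] with x hx
      rw [Pi.sub_apply, hx]
    · filter_upwards [hΩ.coeFn_boundaryValue (φ k)] with x hx
      rw [Pi.sub_apply, hx]
  rw [IsPolygonalDomain.traceGraph, ← SetLike.mem_coe, Submodule.topologicalClosure_coe,
    mem_closure_iff_seq_limit]
  constructor
  · rintro ⟨φ, h1, h2⟩
    exact ⟨_, fun k => ⟨⟨φ k, h1 k⟩, rfl⟩, (key fun k => ⟨φ k, h1 k⟩).2 h2⟩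
  · rintro ⟨p, hp, hlim⟩
    choose φ hφ using hp
    refine ⟨fun k => φ k, fun k => contDiff_smoothFn (φ k), (key φ).1 ?_⟩
    exact hlim.congr fun k => (hφ k).symm

omit hΩ in
lemma norm_sq_eq_lintegral {F : Type*} [NormedAddCommGroup F] {μ : Measure (E n)} (f : Lp F 2 μ) :
    ENNReal.ofReal (‖f‖ ^ 2) = ∫⁻ x, ‖f x‖ₑ ^ 2 ∂μ := by
  have h := eLpNorm_nnreal_pow_eq_lintegral (f := f) (μ := μ) (p := 2) (by norm_num)
  rw [← enorm_sq_eq_ofReal, Lp.enorm_def]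
  simpa using h

omit hΩ in
lemma lintegral_enorm_sq_congr {F : Type*} [NormedAddCommGroup F] {μ : Measure (E n)}
    {f g : E n → F} (h : f =ᵐ[μ] g) : ∫⁻ x, ‖f x‖ₑ ^ 2 ∂μ = ∫⁻ x, ‖g x‖ₑ ^ 2 ∂μ :=
  lintegral_congr_ae (h.mono fun x hx => by simp only [hx])

/-- The trace inequality. -/
lemma IsPolygonalDomain.exists_trace_le : ∃ C : ℝ, 0 ≤ C ∧ ∀ p ∈ hΩ.traceGraph,
    ‖p.2‖ ^ 2 ≤ C * ‖p.1‖ ^ 2 := by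
  obtain ⟨C, hC⟩ := hΩ.exists_trace
  refine ⟨C, C.2, fun p hp => ?_⟩
  have hcl : IsClosed {p : H1 Ω × Lp ℝ 2 (surfaceMeasure Ω) | ‖p.2‖ ^ 2 ≤ C * ‖p.1‖ ^ 2} :=
    isClosed_le (by fun_prop) (by fun_prop)
  refine closure_minimal ?_ hcl hp
  rintro - ⟨φ, rfl⟩
  rw [mem_ofPred_eq]
  simp only [LinearMap.prod_apply, Function.prod_apply, H1.norm_sq]
  rw [← ENNReal.ofReal_le_ofReal_iff (by positivity), ENNReal.ofReal_mul C.coe_nonneg,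
    ENNReal.ofReal_add (by positivity) (by positivity), norm_sq_eq_lintegral,
    norm_sq_eq_lintegral, norm_sq_eq_lintegral, ENNReal.ofReal_coe_nnreal]
  have h := hC φ (contDiff_smoothFn φ)
  have hφc := (continuous_smoothFn φ)
  rw [lintegral_add_left (Continuous.measurable (by fun_prop))] at h
  rwa [lintegral_enorm_sq_congr (hΩ.coeFn_boundaryValue φ),
    lintegral_enorm_sq_congr (hΩ.coeFn_ofSmooth φ),
    lintegral_enorm_sq_congr (hΩ.coeFn_grad_ofSmooth φ)]

/-- Friedrichs' inequality on `H¹(Ω)`. -/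
lemma IsPolygonalDomain.exists_friedrichs_le {Γ : Set (E n)} (hpos : 0 < surfaceMeasure Ω Γ) :
    ∃ C : ℝ, 0 ≤ C ∧ ∀ p ∈ hΩ.traceGraph, ‖p.1.toL2‖ ^ 2 ≤ C * (‖p.1.grad‖ ^ 2 +
      ‖LpToLpRestrictCLM (E n) ℝ ℝ (surfaceMeasure Ω) 2 Γ p.2‖ ^ 2) := by
  obtain ⟨C, hC⟩ := hΩ.exists_friedrichs hpos
  refine ⟨C, C.2, fun p hp => ?_⟩
  have hcl : IsClosed {p : H1 Ω × Lp ℝ 2 (surfaceMeasure Ω) | ‖p.1.toL2‖ ^ 2 ≤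
      C * (‖p.1.grad‖ ^ 2 + ‖LpToLpRestrictCLM (E n) ℝ ℝ (surfaceMeasure Ω) 2 Γ p.2‖ ^ 2)} := by
    simp only [← gradL_apply, ← toL2L_apply]
    exact isClosed_le (by fun_prop) (by fun_prop)
  refine closure_minimal ?_ hcl hp
  rintro - ⟨φ, rfl⟩
  rw [mem_ofPred_eq]
  simp only [LinearMap.prod_apply, Function.prod_apply]
  rw [← ENNReal.ofReal_le_ofReal_iff (by positivity), ENNReal.ofReal_mul C.coe_nonneg,
    ENNReal.ofReal_add (by positivity) (by positivity), norm_sq_eq_lintegral,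
    norm_sq_eq_lintegral, norm_sq_eq_lintegral, ENNReal.ofReal_coe_nnreal]
  have hΓ := (LpToLpRestrictCLM_coeFn ℝ Γ (hΩ.boundaryValue φ)).trans
    (ae_restrict_of_ae (s := Γ) (hΩ.coeFn_boundaryValue φ))
  rw [lintegral_enorm_sq_congr hΓ, lintegral_enorm_sq_congr (hΩ.coeFn_ofSmooth φ),
    lintegral_enorm_sq_congr (hΩ.coeFn_grad_ofSmooth φ)]
  exact hC φ (contDiff_smoothFn φ)

end Smooth

/-! ### Approximation by nonnegative smooth functions -/

section PositiveApproximation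

/-- A smooth nonnegative approximation of the positive part, whose derivative lies between `0` and
`1`. -/
noncomputable def smoothPos (ε t : ℝ) : ℝ := (t + √(t ^ 2 + ε ^ 2)) / 2

lemma contDiff_smoothPos {ε : ℝ} (hε : 0 < ε) : ContDiff ℝ ∞ (smoothPos ε) := by
  have h : ∀ t : ℝ, t ^ 2 + ε ^ 2 ≠ 0 := fun t => by positivity
  exact (contDiff_id.add (((contDiff_id.pow 2).add contDiff_const).sqrt h)).div_const 2

lemma abs_le_sqrt_sq_add (ε t : ℝ) : |t| ≤ √(t ^ 2 + ε ^ 2) := by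
  rw [← Real.sqrt_sq_eq_abs]
  exact Real.sqrt_le_sqrt (by nlinarith [sq_nonneg ε])

lemma smoothPos_nonneg (ε t : ℝ) : 0 ≤ smoothPos ε t := by
  have := abs_le_sqrt_sq_add ε t
  rw [smoothPos]
  linarith [neg_abs_le t]

lemma abs_smoothPos_sub_le {ε : ℝ} (hε : 0 < ε) (t : ℝ) {u : ℝ} (hu : 0 ≤ u) :
    |smoothPos ε t - u| ≤ |t - u| + ε := by
  have h1 := abs_le_sqrt_sq_add ε t
  have h2 : √(t ^ 2 + ε ^ 2) ≤ |t| + ε := by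
    rw [Real.sqrt_le_left (by positivity)]
    nlinarith [sq_abs t, abs_nonneg t]
  rw [smoothPos, abs_le]
  rcases abs_cases t with ⟨h3, _⟩ | ⟨h3, _⟩ <;> rcases abs_cases (t - u) with ⟨h4, _⟩ | ⟨h4, _⟩ <;>
    constructor <;> linarith

lemma exists_hasDerivAt_smoothPos {ε : ℝ} (hε : 0 < ε) (t : ℝ) :
    ∃ d, HasDerivAt (smoothPos ε) d t ∧ |d| ≤ 1 := by
  have hpos : 0 < t ^ 2 + ε ^ 2 := by positivity
  have h1 : HasDerivAt (fun t : ℝ => t ^ 2 + ε ^ 2) (2 * t) t := by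
    simpa using ((hasDerivAt_id t).pow 2).add_const (ε ^ 2)
  have h2 := (((hasDerivAt_id t).add (h1.sqrt hpos.ne')).div_const 2)
  refine ⟨_, h2, ?_⟩
  have h3 : |2 * t / (2 * √(t ^ 2 + ε ^ 2))| ≤ 1 := by
    rw [mul_div_mul_left _ _ two_ne_zero, abs_div, abs_of_pos (Real.sqrt_pos.2 hpos)]
    exact div_le_one_of_le₀ (abs_le_sqrt_sq_add ε t) (Real.sqrt_nonneg _)
  rw [abs_le] at h3 ⊢
  constructor <;> linarith [h3.1, h3.2]

variable {n : ℕ} {Ω : Set (E n)}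

lemma norm_gradient_smoothPos_le {ε : ℝ} (hε : 0 < ε) (φ : smoothFn n) (x : E n) :
    ‖gradient (fun y => smoothPos ε ((φ : E n → ℝ) y)) x‖ ≤ ‖gradient (φ : E n → ℝ) x‖ := by
  obtain ⟨d, hd, hd1⟩ := exists_hasDerivAt_smoothPos hε ((φ : E n → ℝ) x)
  have h := hd.comp_hasFDerivAt x (differentiableAt_smoothFn φ x).hasFDerivAt
  have h' : fderiv ℝ (fun y => smoothPos ε ((φ : E n → ℝ) y)) x =
    d • fderiv ℝ (φ : E n → ℝ) x := h.fderiv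
  rw [gradient, gradient, LinearIsometryEquiv.norm_map, LinearIsometryEquiv.norm_map, h',
    norm_smul]
  exact mul_le_of_le_one_left (norm_nonneg _) hd1

/-- Regularized positive part of a smooth function. -/
noncomputable def posApprox (ε : ℝ) (hε : 0 < ε) (φ : smoothFn n) : smoothFn n :=
  ⟨fun x => smoothPos ε ((φ : E n → ℝ) x),
    ((contDiff_smoothPos hε).comp (contDiff_smoothFn φ) : ContDiff ℝ ∞ _)⟩

variable (hΩ : IsPolygonalDomain Ω)
include hΩ

lemma IsPolygonalDomain.ofSmooth_mem_traceGraph (φ : smoothFn n) :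
    (hΩ.ofSmooth φ, hΩ.boundaryValue φ) ∈ hΩ.traceGraph :=
  subset_closure ⟨φ, rfl⟩

/-- By the trace inequality, two sequences of smooth functions with the same limit in `H¹(Ω)` have
the same limit on the boundary. -/
lemma IsPolygonalDomain.tendsto_boundaryValue {φ ψ : ℕ → smoothFn n} {u : H1 Ω}
    {w : Lp ℝ 2 (surfaceMeasure Ω)} (hφ : Tendsto (fun k => hΩ.ofSmooth (φ k)) atTop (𝓝 u))
    (hψ : Tendsto (fun k => hΩ.ofSmooth (ψ k)) atTop (𝓝 u))
    (hB : Tendsto (fun k => hΩ.boundaryValue (φ k)) atTop (𝓝 w)) :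
    Tendsto (fun k => hΩ.boundaryValue (ψ k)) atTop (𝓝 w) := by
  obtain ⟨C, -, hC⟩ := hΩ.exists_trace_le
  have hC' : ∀ χ : smoothFn n, ‖hΩ.boundaryValue χ‖ ^ 2 ≤ C * ‖hΩ.ofSmooth χ‖ ^ 2 := fun χ =>
    hC (hΩ.ofSmooth χ, hΩ.boundaryValue χ) (hΩ.ofSmooth_mem_traceGraph χ)
  have h1 : Tendsto (fun k => C * ‖hΩ.ofSmooth (ψ k - φ k)‖ ^ 2) atTop (𝓝 0) := by
    have h := hψ.sub hφ
    rw [sub_self] at h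
    simp_rw [map_sub]
    simpa using (h.norm.pow 2).const_mul C
  have h2 : Tendsto (fun k => hΩ.boundaryValue (ψ k - φ k)) atTop (𝓝 0) := by
    rw [tendsto_zero_iff_norm_tendsto_zero]
    simpa using (squeeze_zero (fun k => sq_nonneg _) (fun k => hC' (ψ k - φ k)) h1).sqrt
  simpa using h2.add hB

lemma IsPolygonalDomain.exists_norm_posApprox_sub_le : ∃ C : ℝ, ∀ (ε : ℝ) (hε : 0 < ε)
    (φ : smoothFn n) (u : H1 Ω), u ∈ Kplus Ω →
      ‖(hΩ.ofSmooth (posApprox ε hε φ)).toL2 - u.toL2‖ ≤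
        ‖(hΩ.ofSmooth φ).toL2 - u.toL2‖ + ε * C := by
  let one : smoothFn n := ⟨fun _ => 1, (contDiff_const : ContDiff ℝ ∞ fun _ : E n => (1 : ℝ))⟩
  refine ⟨‖(hΩ.ofSmooth one).toL2‖, fun ε hε φ u hu => ?_⟩
  have h1 : ‖(hΩ.ofSmooth (posApprox ε hε φ)).toL2 - u.toL2‖ ≤
      ‖|(hΩ.ofSmooth φ).toL2 - u.toL2| + ε • (hΩ.ofSmooth one).toL2‖ := by
    refine Lp.norm_le_norm_of_ae_le ?_
    have hu' : ∀ᵐ x ∂volume.restrict Ω, 0 ≤ u.toL2 x := hu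
    filter_upwards [hu', Lp.coeFn_sub (hΩ.ofSmooth (posApprox ε hε φ)).toL2 u.toL2,
      hΩ.coeFn_ofSmooth (posApprox ε hε φ), hΩ.coeFn_ofSmooth φ, hΩ.coeFn_ofSmooth one,
      Lp.coeFn_sub (hΩ.ofSmooth φ).toL2 u.toL2, Lp.coeFn_abs ((hΩ.ofSmooth φ).toL2 - u.toL2),
      Lp.coeFn_add |(hΩ.ofSmooth φ).toL2 - u.toL2| (ε • (hΩ.ofSmooth one).toL2),
      Lp.coeFn_smul ε (hΩ.ofSmooth one).toL2] with x h0 h1 h2 h3 h4 h5 h6 h7 h8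
    rw [h1, h7, Pi.sub_apply, Pi.add_apply, h2, h6, h5, h8, Pi.sub_apply, Pi.smul_apply, h3, h4,
      Real.norm_eq_abs]
    refine (abs_smoothPos_sub_le hε _ h0).trans ?_
    simp only [one, smul_eq_mul, mul_one]
    exact le_abs_self _
  refine h1.trans ((norm_add_le _ _).trans_eq ?_)
  rw [norm_abs_eq_norm, norm_smul, Real.norm_of_nonneg hε.le]

lemma IsPolygonalDomain.norm_grad_posApprox_le {ε : ℝ} (hε : 0 < ε) (φ : smoothFn n) :
    ‖(hΩ.ofSmooth (posApprox ε hε φ)).grad‖ ≤ ‖(hΩ.ofSmooth φ).grad‖ := by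
  refine Lp.norm_le_norm_of_ae_le ?_
  filter_upwards [hΩ.coeFn_grad_ofSmooth φ, hΩ.coeFn_grad_ofSmooth (posApprox ε hε φ)] with x h1 h2
  rw [h1, h2]
  exact norm_gradient_smoothPos_le hε φ x

/-- A nonnegative function of `H¹(Ω)` and its trace are approximated by nonnegative smooth
functions. The positive parts of an approximating sequence converge weakly, and the norms of their
gradients do not exceed the norms of the gradients of that sequence in the limit, so that the
convergence is strong. -/
lemma IsPolygonalDomain.mem_closure_nonneg {u : H1 Ω} {w : Lp ℝ 2 (surfaceMeasure Ω)}
    (huw : (u, w) ∈ hΩ.traceGraph) (hu : u ∈ Kplus Ω) :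
    (u, w) ∈ closure {p | ∃ ψ : smoothFn n, (∀ x, 0 ≤ (ψ : E n → ℝ) x) ∧
      (hΩ.ofSmooth ψ, hΩ.boundaryValue ψ) = p} := by
  rw [IsPolygonalDomain.traceGraph, ← SetLike.mem_coe, Submodule.topologicalClosure_coe,
    mem_closure_iff_seq_limit] at huw
  obtain ⟨p, hp, hlim⟩ := huw
  choose φ hφ using hp
  obtain rfl : (fun k => (hΩ.ofSmooth (φ k), hΩ.boundaryValue (φ k))) = p := funext hφ
  rw [Prod.tendsto_iff, tendsto_H1_iff] at hlim
  obtain ⟨⟨hL, hG⟩, hB⟩ := hlim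
  dsimp only at hL hG hB
  set ε : ℕ → ℝ := fun k => 1 / ((k : ℝ) + 1) with hε
  have hεpos : ∀ k, 0 < ε k := fun k => by positivity
  set ψ : ℕ → smoothFn n := fun k => posApprox (ε k) (hεpos k) (φ k) with hψ
  -- convergence in `L²(Ω)`
  have hL' : Tendsto (fun k => (hΩ.ofSmooth (ψ k)).toL2) atTop (𝓝 u.toL2) := by
    obtain ⟨C, hC⟩ := hΩ.exists_norm_posApprox_sub_le
    rw [tendsto_iff_norm_sub_tendsto_zero] at hL ⊢
    refine squeeze_zero (fun k => norm_nonneg _) (fun k => hC (ε k) (hεpos k) (φ k) u hu) ?_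
    simpa [hε] using hL.add ((tendsto_one_div_add_atTop_nhds_zero_nat (𝕜 := ℝ)).mul_const C)
  -- convergence of the gradients
  have hG' : Tendsto (fun k => (hΩ.ofSmooth (ψ k)).grad) atTop (𝓝 u.grad) := by
    have hle : ∀ k, ‖(hΩ.ofSmooth (ψ k)).grad‖ ≤ ‖(hΩ.ofSmooth (φ k)).grad‖ := fun k =>
      hΩ.norm_grad_posApprox_le (hεpos k) (φ k)
    obtain ⟨M, hM⟩ := hG.norm.bddAbove_range
    have hM' : ∀ k, ‖(hΩ.ofSmooth (φ k)).grad‖ ≤ M := fun k => hM ⟨k, rfl⟩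
    have hweak := tendsto_inner_grad hΩ.isOpen (w := fun k => hΩ.ofSmooth (ψ k) - u)
      (M := M + ‖u.grad‖)
      (fun k => (norm_sub_le _ _).trans (add_le_add ((hle k).trans (hM' k)) le_rfl))
      (by
        have := hL'.sub_const u.toL2
        rw [sub_self] at this
        exact this) u.grad
    rw [tendsto_iff_norm_sub_tendsto_zero]
    have hsq : Tendsto (fun k => ‖(hΩ.ofSmooth (ψ k)).grad - u.grad‖ ^ 2) atTop (𝓝 0) := by
      refine squeeze_zero (fun k => sq_nonneg _) (g := fun k => ‖(hΩ.ofSmooth (φ k)).grad‖ ^ 2 -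
        2 * ⟪u.grad, (hΩ.ofSmooth (ψ k) - u).grad⟫ - ‖u.grad‖ ^ 2) (fun k => ?_) ?_
      · have h1 : (hΩ.ofSmooth (ψ k) - u).grad = (hΩ.ofSmooth (ψ k)).grad - u.grad := rfl
        rw [h1, inner_sub_right, real_inner_self_eq_norm_sq, norm_sub_sq_real,
          real_inner_comm u.grad]
        have := pow_le_pow_left₀ (norm_nonneg _) (hle k) 2
        linarith
      · have := ((hG.norm.pow 2).sub (hweak.const_mul 2)).sub_const (‖u.grad‖ ^ 2)
        simpa using this
    have := hsq.sqrt
    simpa using this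
  have hV : Tendsto (fun k => hΩ.ofSmooth (ψ k)) atTop (𝓝 u) := tendsto_H1_iff.2 ⟨hL', hG'⟩
  have hB' : Tendsto (fun k => hΩ.boundaryValue (ψ k)) atTop (𝓝 w) :=
    hΩ.tendsto_boundaryValue (tendsto_H1_iff.2 ⟨hL, hG⟩) hV hB
  refine mem_closure_of_tendsto (hV.prodMk_nhds hB') (Eventually.of_forall fun k => ?_)
  exact ⟨ψ k, fun x => smoothPos_nonneg _ _, rfl⟩

end PositiveApproximation

/-! ### Lagrange interpolation on a triangulation -/

section Simplices

variable {n : ℕ}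

lemma eq_zero_of_affineIndependent {s : Finset (E n)}
    (hs : AffineIndependent ℝ ((↑) : s → E n)) {w : E n → ℝ} (h0 : ∑ i ∈ s, w i = 0)
    (h1 : ∑ i ∈ s, w i • i = 0) : ∀ i ∈ s, w i = 0 := by
  rw [affineIndependent_iff] at hs
  intro i hi
  refine hs Finset.univ (fun i => w i) ?_ ?_ ⟨i, hi⟩ (Finset.mem_univ _)
  · rw [← h0]
    exact Finset.sum_coe_sort s w
  · rw [← h1]
    exact Finset.sum_coe_sort s fun i => w i • i

lemma affineMap_sum_smul (p : E n →ᵃ[ℝ] ℝ) {s : Finset (E n)} {w : E n → ℝ}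
    (hw : ∑ i ∈ s, w i = 1) : p (∑ i ∈ s, w i • i) = ∑ i ∈ s, w i * p i := by
  obtain ⟨c, h⟩ : ∃ c, ∀ x, p x = p.linear x + c := ⟨p 0, fun x => congrFun (AffineMap.decomp p) x⟩
  simp_rw [h, map_sum, map_smul, smul_eq_mul, mul_add, Finset.sum_add_distrib, ← Finset.sum_mul,
    hw, one_mul]

/-- The affine interpolant of a function at the vertices of a simplex. -/
lemma exists_affineMap_eq {s : Finset (E n)} (hcard : s.card = n + 1)
    (hs : AffineIndependent ℝ ((↑) : s → E n)) (ψ : E n → ℝ) :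
    ∃ p : E n →ᵃ[ℝ] ℝ, ∀ v ∈ s, p v = ψ v := by
  classical
  refine ⟨∑ i : s, ψ i • (simplexBasis hcard hs).coord i, fun v hv => ?_⟩
  have h : ∀ i : s, (simplexBasis hcard hs).coord i v = if i = ⟨v, hv⟩ then 1 else 0 :=
    fun i => (simplexBasis hcard hs).coord_apply i ⟨v, hv⟩
  have h2 : (∑ i : s, ψ i • (simplexBasis hcard hs).coord i) v =
      ∑ i : s, ψ i * (simplexBasis hcard hs).coord i v := by
    induction (Finset.univ : Finset s) using Finset.induction_on with
    | empty => simp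
    | insert a t ha ih => rw [Finset.sum_insert ha, Finset.sum_insert ha, ← ih]; rfl
  simp only [h2, h, mul_ite, mul_one, mul_zero, Finset.sum_ite_eq', Finset.mem_univ, if_true]

/-- If two simplices meet along their common face, a combination of their vertices which is
nonnegative off the second and nonpositive off the first vanishes only if it is trivial: after
normalization, its positive and its negative part represent the same point of the common face. -/
lemma eq_zero_of_sum_smul_eq_zero [DecidableEq (E n)] {s t : Finset (E n)}
    (hs : AffineIndependent ℝ ((↑) : s → E n)) (ht : AffineIndependent ℝ ((↑) : t → E n))
    (hst : convexHull ℝ (s : Set (E n)) ∩ convexHull ℝ (t : Set (E n)) ⊆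
      convexHull ℝ ((s : Set (E n)) ∩ t))
    {c : E n → ℝ} (hcs : ∀ i ∉ s, c i ≤ 0) (hct : ∀ i ∉ t, 0 ≤ c i)
    (h0 : ∑ i ∈ s ∪ t, c i = 0) (h1 : ∑ i ∈ s ∪ t, c i • i = 0) : ∀ i, c i = 0 := by
  have hpn : ∀ i, c i = max (c i) 0 - max (-c i) 0 := fun i => by
    rcases le_total 0 (c i) with h | h <;> simp [h]
  have hp : ∀ i ∉ s, max (c i) 0 = 0 := fun i hi => max_eq_right (hcs i hi)
  have hm : ∀ i ∉ t, max (-c i) 0 = 0 := fun i hi => max_eq_right (by linarith [hct i hi])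
  have es1 : ∑ i ∈ s, max (c i) 0 = ∑ i ∈ s ∪ t, max (c i) 0 :=
    Finset.sum_subset Finset.subset_union_left fun i _ hi => hp i hi
  have et1 : ∑ i ∈ t, max (-c i) 0 = ∑ i ∈ s ∪ t, max (-c i) 0 :=
    Finset.sum_subset Finset.subset_union_right fun i _ hi => hm i hi
  have es2 : ∑ i ∈ s, max (c i) 0 • i = ∑ i ∈ s ∪ t, max (c i) 0 • i :=
    Finset.sum_subset Finset.subset_union_left fun i _ hi => by rw [hp i hi, zero_smul]
  have et2 : ∑ i ∈ t, max (-c i) 0 • i = ∑ i ∈ s ∪ t, max (-c i) 0 • i :=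
    Finset.sum_subset Finset.subset_union_right fun i _ hi => by rw [hm i hi, zero_smul]
  have e1 : ∑ i ∈ s, max (c i) 0 = ∑ i ∈ t, max (-c i) 0 := by
    rw [es1, et1, ← sub_eq_zero, ← Finset.sum_sub_distrib]
    exact (Finset.sum_congr rfl fun i _ => (hpn i).symm).trans h0
  have e2 : ∑ i ∈ s, max (c i) 0 • i = ∑ i ∈ t, max (-c i) 0 • i := by
    rw [es2, et2, ← sub_eq_zero, ← Finset.sum_sub_distrib]
    exact (Finset.sum_congr rfl fun i _ => by rw [← sub_smul, ← hpn i]).trans h1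
  set m := ∑ i ∈ s, max (c i) 0 with hmdef
  have hm0 : 0 ≤ m := Finset.sum_nonneg fun i _ => le_max_right _ _
  -- both parts are proportional to the same weights `d`, supported in `s ∩ t`
  obtain ⟨d, hds, hdt⟩ : ∃ d : E n → ℝ, (∀ i ∈ s, max (c i) 0 = if i ∈ s ∩ t then d i else 0) ∧
      (∀ i ∈ t, max (-c i) 0 = if i ∈ s ∩ t then d i else 0) := by
    rcases hm0.eq_or_lt with hm0 | hm0
    · refine ⟨0, fun i hi => ?_, fun i hi => ?_⟩
      · have := (Finset.sum_eq_zero_iff_of_nonneg (fun i _ => le_max_right (c i) 0)).1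
          (hmdef.symm.trans hm0.symm) i hi
        simp [this]
      · have := (Finset.sum_eq_zero_iff_of_nonneg (fun i _ => le_max_right (-c i) 0)).1
          (e1.symm.trans hm0.symm) i hi
        simp [this]
    · set z := ∑ i ∈ s, (max (c i) 0 / m) • i with hz
      have hzs : z ∈ convexHull ℝ (s : Set (E n)) := by
        refine Finset.mem_convexHull'.2
          ⟨fun i => max (c i) 0 / m, fun i _ => by positivity, ?_, rfl⟩
        rw [← Finset.sum_div, ← hmdef, div_self hm0.ne']
      have hzt' : z = ∑ i ∈ t, (max (-c i) 0 / m) • i := by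
        rw [hz]
        simp_rw [div_eq_inv_mul, mul_smul, ← Finset.smul_sum, e2]
      have hzt : z ∈ convexHull ℝ (t : Set (E n)) := by
        refine Finset.mem_convexHull'.2
          ⟨fun i => max (-c i) 0 / m, fun i _ => by positivity, ?_, hzt'.symm⟩
        rw [← Finset.sum_div, ← e1, div_self hm0.ne']
      have hzst := hst ⟨hzs, hzt⟩
      rw [← Finset.coe_inter, Finset.mem_convexHull'] at hzst
      obtain ⟨d, -, hd1, hd2⟩ := hzst
      refine ⟨fun i => m * d i, fun i hi => ?_, fun i hi => ?_⟩
      · have := eq_zero_of_affineIndependent hs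
          (w := fun i => max (c i) 0 / m - if i ∈ s ∩ t then d i else 0) ?_ ?_ i hi
        · rw [sub_eq_zero, div_eq_iff hm0.ne'] at this
          rw [this, ite_mul, zero_mul, mul_comm]
        · rw [Finset.sum_sub_distrib, ← Finset.sum_div, ← hmdef, div_self hm0.ne',
            Finset.sum_ite_mem, Finset.inter_eq_right.2 Finset.inter_subset_left, hd1, sub_self]
        · simp_rw [sub_smul, ite_smul, zero_smul]
          rw [Finset.sum_sub_distrib, ← hz, Finset.sum_ite_mem,
            Finset.inter_eq_right.2 Finset.inter_subset_left, hd2, sub_self]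
      · have := eq_zero_of_affineIndependent ht
          (w := fun i => max (-c i) 0 / m - if i ∈ s ∩ t then d i else 0) ?_ ?_ i hi
        · rw [sub_eq_zero, div_eq_iff hm0.ne'] at this
          rw [this, ite_mul, zero_mul, mul_comm]
        · rw [Finset.sum_sub_distrib, ← Finset.sum_div, ← e1, div_self hm0.ne',
            Finset.sum_ite_mem, Finset.inter_eq_right.2 Finset.inter_subset_right, hd1, sub_self]
        · simp_rw [sub_smul, ite_smul, zero_smul]
          rw [Finset.sum_sub_distrib, ← hzt', Finset.sum_ite_mem,
            Finset.inter_eq_right.2 Finset.inter_subset_right, hd2, sub_self]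
  intro i
  rw [hpn i, sub_eq_zero]
  by_cases his : i ∈ s <;> by_cases hit : i ∈ t
  · rw [hds i his, hdt i hit]
  · rw [hds i his, hm i hit, if_neg (by simp [hit])]
  · rw [hdt i hit, hp i his, if_neg (by simp [his])]
  · rw [hp i his, hm i hit]

/-- A linear map which is injective at the origin of a closed cone is bounded below on the cone, by
compactness of the unit sphere. -/
lemma exists_pos_mul_norm_le_of_cone {V W : Type*} [NormedAddCommGroup V] [NormedSpace ℝ V]
    [FiniteDimensional ℝ V] [NormedAddCommGroup W] [NormedSpace ℝ W] (A : V →ₗ[ℝ] W) {S : Set V}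
    (hS : IsClosed S) (hcone : ∀ c ∈ S, ∀ r : ℝ, 0 ≤ r → r • c ∈ S)
    (hinj : ∀ c ∈ S, A c = 0 → c = 0) : ∃ δ > 0, ∀ c ∈ S, δ * ‖c‖ ≤ ‖A c‖ := by
  have := FiniteDimensional.proper_real V
  have hA : Continuous A := A.continuous_of_finiteDimensional
  have hscale : ∀ c ∈ S, c ≠ 0 → ‖c‖⁻¹ • c ∈ S ∩ Metric.sphere 0 1 := fun c hc h =>
    ⟨hcone c hc _ (inv_nonneg.2 (norm_nonneg c)), by simp [norm_smul, h]⟩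
  rcases (S ∩ Metric.sphere 0 1).eq_empty_or_nonempty with he | hne
  · refine ⟨1, one_pos, fun c hc => ?_⟩
    by_cases h : c = 0
    · simp [h]
    · exact absurd (hscale c hc h) (by simp [he])
  · obtain ⟨c₀, hc₀, hmin⟩ :=
      ((isCompact_sphere (0 : V) 1).inter_left hS).exists_isMinOn hne hA.norm.continuousOn
    refine ⟨‖A c₀‖, norm_pos_iff.2 fun h => ?_, fun c hc => ?_⟩
    · rw [hinj c₀ hc₀.1 h] at hc₀
      simpa using hc₀.2
    · by_cases h : c = 0
      · simp [h]
      have h2 : ‖A c₀‖ ≤ ‖A (‖c‖⁻¹ • c)‖ := isMinOn_iff.1 hmin _ (hscale c hc h)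
      rwa [map_smul, norm_smul, norm_inv, norm_norm, ← div_eq_inv_mul,
        le_div_iff₀ (norm_pos_iff.2 h)] at h2

/-- Piecewise affine functions are Lipschitz across two simplices meeting along their common face.
In terms of the barycentric weights `a` of `x` and `b` of `y`, the differences `a - b` form a closed
cone on which `x - y` vanishes only for `a = b`, so that `x - y` controls `a - b`. -/
lemma exists_lipschitz_pair [DecidableEq (E n)] {s t : Finset (E n)}
    (hs : AffineIndependent ℝ ((↑) : s → E n)) (ht : AffineIndependent ℝ ((↑) : t → E n))
    (hst : convexHull ℝ (s : Set (E n)) ∩ convexHull ℝ (t : Set (E n)) ⊆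
      convexHull ℝ ((s : Set (E n)) ∩ t)) {ψ : E n → ℝ} {p q : E n →ᵃ[ℝ] ℝ}
    (hp : ∀ v ∈ s, p v = ψ v) (hq : ∀ v ∈ t, q v = ψ v) :
    ∃ L : NNReal, ∀ x ∈ convexHull ℝ (s : Set (E n)), ∀ y ∈ convexHull ℝ (t : Set (E n)),
      dist (p x) (q y) ≤ L * dist x y := by
  -- extension of weights on the vertices by zero
  let ext : ((s ∪ t : Finset (E n)) → ℝ) → E n → ℝ :=
    fun c i => if h : i ∈ s ∪ t then c ⟨i, h⟩ else 0
  have hext : ∀ c (i : (s ∪ t : Finset (E n))), ext c i = c i := fun c i => dif_pos i.2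
  let A : ((s ∪ t : Finset (E n)) → ℝ) →ₗ[ℝ] E n :=
    Fintype.linearCombination ℝ fun i : (s ∪ t : Finset (E n)) => (i : E n)
  have hA : ∀ c, A c = ∑ i ∈ s ∪ t, ext c i • i := fun c => by
    rw [← Finset.sum_coe_sort (s ∪ t) fun i => ext c i • i]
    simp only [A, hext, Fintype.linearCombination_apply]
  have hsum : ∀ c : (s ∪ t : Finset (E n)) → ℝ, ∑ i, c i = ∑ i ∈ s ∪ t, ext c i := fun c => by
    rw [← Finset.sum_coe_sort (s ∪ t) fun i => ext c i]
    simp only [hext]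
  let S : Set ((s ∪ t : Finset (E n)) → ℝ) := {c | ∑ i, c i = 0 ∧
    (∀ i : (s ∪ t : Finset (E n)), (i : E n) ∉ s → c i ≤ 0) ∧
    ∀ i : (s ∪ t : Finset (E n)), (i : E n) ∉ t → 0 ≤ c i}
  have hScl : IsClosed S := by
    have h1 : IsClosed {c : (s ∪ t : Finset (E n)) → ℝ | ∑ i, c i = 0} :=
      isClosed_eq (by fun_prop) continuous_const
    have h2 : IsClosed {c : (s ∪ t : Finset (E n)) → ℝ |
        ∀ i : (s ∪ t : Finset (E n)), (i : E n) ∉ s → c i ≤ 0} := by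
      simp only [ofPred_forall]
      exact isClosed_iInter fun i => isClosed_iInter fun _ =>
        isClosed_le (continuous_apply i) continuous_const
    have h3 : IsClosed {c : (s ∪ t : Finset (E n)) → ℝ |
        ∀ i : (s ∪ t : Finset (E n)), (i : E n) ∉ t → 0 ≤ c i} := by
      simp only [ofPred_forall]
      exact isClosed_iInter fun i => isClosed_iInter fun _ =>
        isClosed_le continuous_const (continuous_apply i)
    exact h1.inter (h2.inter h3)
  have hSA : ∀ c ∈ S, A c = 0 → c = 0 := by
    rintro c ⟨h0, h1, h2⟩ h3
    have := eq_zero_of_sum_smul_eq_zero hs ht hst (c := ext c) ?_ ?_ ((hsum c).symm.trans h0)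
      ((hA c).symm.trans h3)
    · funext i
      exact (hext c i).symm.trans (this i)
    · intro i hi
      by_cases h : i ∈ s ∪ t
      · simpa only [ext, dif_pos h] using h1 ⟨i, h⟩ hi
      · simp only [ext, dif_neg h, le_refl]
    · intro i hi
      by_cases h : i ∈ s ∪ t
      · simpa only [ext, dif_pos h] using h2 ⟨i, h⟩ hi
      · simp only [ext, dif_neg h, le_refl]
  obtain ⟨δ, hδ, hδA⟩ := exists_pos_mul_norm_le_of_cone A hScl (fun c hc r hr =>
    ⟨by simp only [Pi.smul_apply, smul_eq_mul, ← Finset.mul_sum, hc.1, mul_zero],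
      fun i hi => mul_nonpos_of_nonneg_of_nonpos hr (hc.2.1 i hi),
      fun i hi => mul_nonneg hr (hc.2.2 i hi)⟩) hSA
  refine ⟨Real.toNNReal (δ⁻¹ * ∑ i ∈ s ∪ t, |ψ i|), fun x hx y hy => ?_⟩
  rw [Real.coe_toNNReal _ (by positivity)]
  obtain ⟨a, ha0, ha1, rfl⟩ := Finset.mem_convexHull'.1 hx
  obtain ⟨b, hb0, hb1, rfl⟩ := Finset.mem_convexHull'.1 hy
  rw [affineMap_sum_smul p ha1, affineMap_sum_smul q hb1]
  set a' : E n → ℝ := fun i => if i ∈ s then a i else 0 with ha'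
  set b' : E n → ℝ := fun i => if i ∈ t then b i else 0 with hb'
  have ea : ∀ {F : Type} [AddCommMonoid F] (f : E n → ℝ → F), (∀ i, f i 0 = 0) →
      ∑ i ∈ s, f i (a i) = ∑ i ∈ s ∪ t, f i (a' i) := fun f hf => by
    rw [← Finset.sum_subset (Finset.subset_union_left (s₁ := s) (s₂ := t))
      (f := fun i => f i (a' i)) fun i _ hi => by simp [ha', hi, hf]]
    exact Finset.sum_congr rfl fun i hi => by simp [ha', hi]
  have eb : ∀ {F : Type} [AddCommMonoid F] (f : E n → ℝ → F), (∀ i, f i 0 = 0) →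
      ∑ i ∈ t, f i (b i) = ∑ i ∈ s ∪ t, f i (b' i) := fun f hf => by
    rw [← Finset.sum_subset (Finset.subset_union_right (s₁ := s) (s₂ := t))
      (f := fun i => f i (b' i)) fun i _ hi => by simp [hb', hi, hf]]
    exact Finset.sum_congr rfl fun i hi => by simp [hb', hi]
  set c : (s ∪ t : Finset (E n)) → ℝ := fun i => a' i - b' i with hc
  have hcS : c ∈ S := by
    refine ⟨?_, fun i hi => ?_, fun i hi => ?_⟩
    · rw [Finset.sum_coe_sort (s ∪ t) fun i => a' i - b' i, Finset.sum_sub_distrib,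
        ← ea (fun _ x => x) (fun _ => rfl), ← eb (fun _ x => x) (fun _ => rfl), ha1, hb1, sub_self]
    · have hi' : (i : E n) ∈ t := (Finset.mem_union.1 i.2).resolve_left hi
      simpa [hc, ha', hb', hi, hi'] using hb0 i hi'
    · have hi' : (i : E n) ∈ s := (Finset.mem_union.1 i.2).resolve_right hi
      simpa [hc, ha', hb', hi, hi'] using ha0 i hi'
  have hAc : A c = ∑ i ∈ s, a i • i - ∑ i ∈ t, b i • i := by
    rw [ea (fun i x => x • i) (fun _ => zero_smul _ _), eb (fun i x => x • i)
      (fun _ => zero_smul _ _), ← Finset.sum_sub_distrib]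
    simp_rw [← sub_smul]
    exact Finset.sum_coe_sort (s ∪ t) fun i => (a' i - b' i) • i
  have hval : ∑ i ∈ s, a i * p i - ∑ i ∈ t, b i * q i = ∑ i ∈ s ∪ t, (a' i - b' i) * ψ i := by
    have h1 : ∑ i ∈ s, a i * p i = ∑ i ∈ s, a i * ψ i :=
      Finset.sum_congr rfl fun i hi => by rw [hp i hi]
    have h2 : ∑ i ∈ t, b i * q i = ∑ i ∈ t, b i * ψ i :=
      Finset.sum_congr rfl fun i hi => by rw [hq i hi]
    rw [h1, h2, ea (fun i x => x * ψ i) (fun _ => zero_mul _), eb (fun i x => x * ψ i)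
      (fun _ => zero_mul _), ← Finset.sum_sub_distrib]
    simp_rw [← sub_mul]
  rw [Real.dist_eq, hval, dist_eq_norm, ← hAc]
  calc |∑ i ∈ s ∪ t, (a' i - b' i) * ψ i| ≤ ∑ i ∈ s ∪ t, |(a' i - b' i) * ψ i| :=
        Finset.abs_sum_le_sum_abs _ _
    _ ≤ ∑ i ∈ s ∪ t, ‖c‖ * |ψ i| := by
        refine Finset.sum_le_sum fun i hi => ?_
        rw [abs_mul]
        gcongr
        exact norm_le_pi_norm c ⟨i, hi⟩
    _ = δ⁻¹ * (∑ i ∈ s ∪ t, |ψ i|) * (δ * ‖c‖) := by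
        rw [← Finset.mul_sum]
        field_simp
    _ ≤ _ := by
        gcongr
        exact hδA c hcS

end Simplices

section Triangulations

variable {n : ℕ} {Ω : Set (E n)} (𝒯 : Triangulation Ω)

lemma Triangulation.finite_cells : 𝒯.cells.Finite := 𝒯.finite_faces.subset fun _ h => h.1

lemma Triangulation.closure_eq : closure Ω = ⋃ s ∈ 𝒯.cells, convexHull ℝ (s : Set (E n)) := by
  rw [← 𝒯.space_eq, Geometry.SimplicialComplex.space]
  refine Subset.antisymm ?_ (biUnion_mono (fun s hs => hs.1) fun _ _ => subset_rfl)
  refine iUnion₂_subset fun s hs => ?_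
  obtain ⟨t, ht, hst, hcard⟩ := 𝒯.pure s hs
  exact (convexHull_mono (Finset.coe_subset.2 hst)).trans
    (subset_biUnion_of_mem (u := fun t : Finset (E n) => convexHull ℝ (t : Set (E n)))
      (show t ∈ 𝒯.cells from ⟨ht, hcard⟩))

/-- Existence of the Lagrange interpolant, as a Lipschitz function on `ℝⁿ`. -/
lemma Triangulation.exists_interpolant (ψ : E n → ℝ) :
    ∃ (F : E n → ℝ) (L : NNReal) (p : Finset (E n) → (E n →ᵃ[ℝ] ℝ)), LipschitzWith L F ∧
      ∀ s ∈ 𝒯.cells, (∀ v ∈ s, p s v = ψ v) ∧ EqOn F (p s) (convexHull ℝ (s : Set (E n))) := by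
  classical
  have hp : ∀ s : Finset (E n), ∃ p : E n →ᵃ[ℝ] ℝ, s ∈ 𝒯.cells → ∀ v ∈ s, p v = ψ v := by
    intro s
    by_cases hs : s ∈ 𝒯.cells
    · obtain ⟨p, hp⟩ := exists_affineMap_eq hs.2 (𝒯.complex.indep hs.1) ψ
      exact ⟨p, fun _ => hp⟩
    · exact ⟨0, fun h => absurd h hs⟩
  choose p hp using hp
  have hL : ∀ st : 𝒯.cells × 𝒯.cells, ∃ L : NNReal,
      ∀ x ∈ convexHull ℝ ((st.1 : Finset (E n)) : Set (E n)),
      ∀ y ∈ convexHull ℝ ((st.2 : Finset (E n)) : Set (E n)),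
      dist (p st.1 x) (p st.2 y) ≤ L * dist x y := by
    rintro ⟨⟨s, hs⟩, t, ht⟩
    exact exists_lipschitz_pair (𝒯.complex.indep hs.1) (𝒯.complex.indep ht.1)
      (𝒯.complex.inter_subset_convexHull hs.1 ht.1) (hp s hs) (hp t ht)
  choose L hL using hL
  have := 𝒯.finite_cells.fintype
  have hcell : ∀ x : E n, ∃ s, x ∈ closure Ω → s ∈ 𝒯.cells ∧ x ∈ convexHull ℝ (s : Set (E n)) := by
    intro x
    by_cases hx : x ∈ closure Ω
    · have h := hx
      rw [𝒯.closure_eq] at h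
      obtain ⟨s, hs, hxs⟩ := mem_iUnion₂.1 h
      exact ⟨s, fun _ => ⟨hs, hxs⟩⟩
    · exact ⟨∅, fun h => absurd h hx⟩
  choose cell hcell using hcell
  have hlip : LipschitzOnWith (∑ st, L st) (fun x => p (cell x) x) (closure Ω) := by
    refine LipschitzOnWith.of_dist_le_mul fun x hx y hy => ?_
    refine (hL (⟨cell x, (hcell x hx).1⟩, ⟨cell y, (hcell y hy).1⟩) x (hcell x hx).2 y
      (hcell y hy).2).trans ?_
    gcongr
    exact Finset.single_le_sum (f := L) (fun _ _ => zero_le) (Finset.mem_univ _)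
  obtain ⟨F, hF, hFe⟩ := hlip.extend_real
  refine ⟨F, _, p, hF, fun s hs => ⟨hp s hs, fun x hx => ?_⟩⟩
  have hxc : x ∈ closure Ω := by
    rw [𝒯.closure_eq]
    exact mem_iUnion₂.2 ⟨s, hs, hx⟩
  rw [← hFe hxc]
  have := hL (⟨cell x, (hcell x hxc).1⟩, ⟨s, hs⟩) x (hcell x hxc).2 x hx
  rw [dist_self, mul_zero] at this
  exact dist_le_zero.1 this

end Triangulations

/-! ### Lipschitz functions as elements of `H¹(Ω)` -/

section Mollification

variable {n : ℕ} {Ω : Set (E n)}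

lemma tendsto_Lp_of_ae_bounded {F : Type*} [NormedAddCommGroup F] {μ : Measure (E n)}
    [IsFiniteMeasure μ] {f : ℕ → Lp F 2 μ} {g : Lp F 2 μ} {C : ℝ}
    (hb : ∀ k, ∀ᵐ x ∂μ, ‖f k x‖ ≤ C) (h : ∀ᵐ x ∂μ, Tendsto (fun k => f k x) atTop (𝓝 (g x))) :
    Tendsto f atTop (𝓝 g) := by
  have h1 : Tendsto (fun k => ENNReal.ofReal (‖f k - g‖ ^ 2)) atTop (𝓝 0) := by
    simp_rw [norm_sq_eq_lintegral]
    have := tendsto_lintegral_of_dominated_convergence' (μ := μ)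
      (F := fun k x => ‖(f k - g) x‖ₑ ^ 2) (f := fun _ => 0)
      (fun _ => ENNReal.ofReal (2 * C) ^ 2) (fun k => by
        exact (Lp.aestronglyMeasurable _).enorm.pow_const 2) ?_ ?_ ?_
    · simpa using this
    · intro k
      filter_upwards [ae_all_iff.2 hb, h, Lp.coeFn_sub (f k) g] with x h1 h2 h3
      have h4 : ‖g x‖ ≤ C := le_of_tendsto h2.norm (Eventually.of_forall h1)
      rw [h3, Pi.sub_apply, ← ofReal_norm]
      gcongr
      linarith [norm_sub_le (f k x) (g x), h1 k]
    · rw [lintegral_const]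
      exact ENNReal.mul_ne_top (by finiteness) (measure_ne_top _ _)
    · filter_upwards [h, ae_all_iff.2 fun k => Lp.coeFn_sub (f k) g] with x h2 h3
      have h4 : Tendsto (fun k => ‖f k x - g x‖ₑ ^ 2) atTop (𝓝 (‖g x - g x‖ₑ ^ 2)) :=
        ((ENNReal.continuous_pow 2).tendsto _).comp (h2.sub_const (g x)).enorm
      rw [sub_self, enorm_zero, zero_pow two_ne_zero] at h4
      exact h4.congr fun k => by rw [h3, Pi.sub_apply]
  rw [tendsto_iff_norm_sub_tendsto_zero]
  have h2 := ((ENNReal.tendsto_toReal ENNReal.zero_ne_top).comp h1).sqrt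
  simpa [Function.comp_def, ENNReal.toReal_ofReal] using h2

/-- The bump functions used for the mollification. The ratio of their radii is fixed, as Lebesgue's
differentiation theorem requires. -/
noncomputable def mollifier (n k : ℕ) : ContDiffBump (0 : E n) :=
  ⟨1 / ((k : ℝ) + 1), 2 * (1 / ((k : ℝ) + 1)), by positivity,
    lt_two_mul_self (by positivity)⟩

/-- Mollification of a continuous function. -/
noncomputable def mollify (F : E n → ℝ) (hF : Continuous F) (k : ℕ) : smoothFn n :=
  ⟨convolution ((mollifier n k).normed volume) F (ContinuousLinearMap.lsmul ℝ ℝ) volume,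
    ((mollifier n k).hasCompactSupport_normed.contDiff_convolution_left _
      (n := ⊤) (mollifier n k).contDiff_normed hF.locallyIntegrable : ContDiff ℝ ∞ _)⟩

lemma tendsto_mollifier_rOut : Tendsto (fun k => (mollifier n k).rOut) atTop (𝓝 0) := by
  have := (tendsto_one_div_add_atTop_nhds_zero_nat (𝕜 := ℝ)).const_mul 2
  rwa [mul_zero] at this

lemma tendsto_mollify {F : E n → ℝ} (hF : Continuous F) (x : E n) :
    Tendsto (fun k => (mollify F hF k : E n → ℝ) x) atTop (𝓝 (F x)) :=
  ContDiffBump.convolution_tendsto_right_of_continuous tendsto_mollifier_rOut hF x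

lemma abs_mollify_sub_le {F : E n → ℝ} {L : NNReal} (hF : LipschitzWith L F) (k : ℕ) (x : E n) :
    |(mollify F hF.continuous k : E n → ℝ) x - F x| ≤ L * 2 := by
  refine ContDiffBump.dist_normed_convolution_le hF.continuous.aestronglyMeasurable
    fun y hy => (hF.dist_le_mul y x).trans ?_
  gcongr
  refine (Metric.mem_ball.1 hy).le.trans ?_
  have : 1 / ((k : ℝ) + 1) ≤ 1 := by
    rw [div_le_one (by positivity)]
    linarith [Nat.cast_nonneg (α := ℝ) k]
  change 2 * (1 / ((k : ℝ) + 1)) ≤ 2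
  linarith

/-- By Rademacher's theorem, the derivative of the mollification of a Lipschitz function is the
mollification of its derivative. -/
lemma fderiv_mollify {F : E n → ℝ} {L : NNReal} (hF : LipschitzWith L F) (k : ℕ) (x : E n) :
    fderiv ℝ (mollify F hF.continuous k : E n → ℝ) x =
      convolution ((mollifier n k).normed volume) (fderiv ℝ F) (ContinuousLinearMap.lsmul ℝ ℝ)
        volume x := by
  have hη := (mollifier n k).continuous_normed (μ := volume)
  have hηc := (mollifier n k).hasCompactSupport_normed (μ := volume)
  have hFc := hF.continuous
  refine (hasFDerivAt_integral_of_dominated_loc_of_lip (s := univ) (μ := volume)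
    (F := fun y t => (mollifier n k).normed volume t • F (y - t))
    (F' := fun t => (mollifier n k).normed volume t • fderiv ℝ F (x - t))
    (bound := fun t => (mollifier n k).normed volume t * L) univ_mem
    (Eventually.of_forall fun y => ?_) ?_ ?_ (ae_of_all _ fun t => ?_) ?_ ?_).2.fderiv
  · exact Continuous.aestronglyMeasurable (by fun_prop)
  · exact Continuous.integrable_of_hasCompactSupport (by fun_prop) hηc.smul_right
  · exact hη.aestronglyMeasurable.smul
      ((measurable_fderiv ℝ F).comp (measurable_const.sub measurable_id)).aestronglyMeasurable
  · refine (LipschitzWith.of_dist_le_mul fun y z => ?_).lipschitzOnWith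
    rw [dist_smul₀, Real.coe_nnabs, abs_mul, mul_assoc, NNReal.abs_eq, Real.norm_eq_abs]
    gcongr
    simpa using hF.dist_le_mul (y - t) (z - t)
  · exact (mollifier n k).integrable_normed.mul_const _
  · filter_upwards [(Measure.measurePreserving_sub_left volume x).quasiMeasurePreserving.ae
      hF.ae_differentiableAt] with t ht
    have h : HasFDerivAt (fun y => F (y - t)) (fderiv ℝ F (x - t)) x :=
      (hasFDerivAt_comp_sub t).2 ht.hasFDerivAt
    exact h.const_smul ((mollifier n k).normed volume t)

lemma norm_gradient_mollify_le {F : E n → ℝ} {L : NNReal} (hF : LipschitzWith L F) (k : ℕ)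
    (x : E n) : ‖gradient (mollify F hF.continuous k : E n → ℝ) x‖ ≤ L := by
  rw [gradient, LinearIsometryEquiv.norm_map, fderiv_mollify hF]
  have h := norm_integral_le_of_norm_le (μ := volume)
    ((mollifier n k).integrable_normed.mul_const (L : ℝ))
    (f := fun t => (mollifier n k).normed volume t • fderiv ℝ F (x - t)) (ae_of_all _ fun t => ?_)
  · rwa [integral_mul_const, ContDiffBump.integral_normed, one_mul] at h
  · rw [norm_smul, Real.norm_of_nonneg ((mollifier n k).nonneg_normed t)]
    gcongr
    exacts [(mollifier n k).nonneg_normed t, norm_fderiv_le_of_lipschitz ℝ hF]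

lemma ae_tendsto_gradient_mollify {F : E n → ℝ} {L : NNReal} (hF : LipschitzWith L F) :
    ∀ᵐ x, Tendsto (fun k => gradient (mollify F hF.continuous k : E n → ℝ) x) atTop
      (𝓝 (gradient F x)) := by
  have hloc : LocallyIntegrable (fderiv ℝ F) (volume : Measure (E n)) :=
    (memLp_top_of_bound (measurable_fderiv ℝ F).aestronglyMeasurable L
      (ae_of_all _ fun x => norm_fderiv_le_of_lipschitz ℝ hF)).locallyIntegrable le_top
  filter_upwards [ContDiffBump.ae_convolution_tendsto_right_of_locallyIntegrable
    (φ := mollifier n) (K := 2) tendsto_mollifier_rOut (Eventually.of_forall fun k => le_rfl) hloc]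
    with x hx
  simp_rw [gradient, fderiv_mollify hF]
  exact ((InnerProductSpace.toDual ℝ (E n)).symm.continuous.tendsto _).comp hx

lemma measurable_gradient (F : E n → ℝ) : Measurable (gradient F) :=
  (InnerProductSpace.toDual ℝ (E n)).symm.continuous.measurable.comp (measurable_fderiv ℝ F)

/-- A Lipschitz function belongs to `H¹(Ω)`, and its trace is its restriction to the boundary. -/
lemma IsPolygonalDomain.exists_of_lipschitz (hΩ : IsPolygonalDomain Ω) {F : E n → ℝ} {L : NNReal}
    (hF : LipschitzWith L F) : ∃ (v : H1 Ω) (γ : Lp ℝ 2 (surfaceMeasure Ω)),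
      (v, γ) ∈ hΩ.traceGraph ∧ v.toL2 =ᵐ[volume.restrict Ω] F ∧
      v.grad =ᵐ[volume.restrict Ω] gradient F ∧ γ =ᵐ[surfaceMeasure Ω] F := by
  have := hΩ.isFiniteMeasure_restrict
  have := hΩ.isFiniteMeasure_surfaceMeasure
  have hFc := hF.continuous
  have m1 : MemLp F 2 (volume.restrict Ω) := hΩ.memLp_of_continuous hFc
  have m2 : MemLp (gradient F) 2 (volume.restrict Ω) :=
    MemLp.of_bound (measurable_gradient F).aestronglyMeasurable L (ae_of_all _ fun x => by
      rw [gradient, LinearIsometryEquiv.norm_map]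
      exact norm_fderiv_le_of_lipschitz ℝ hF)
  have m3 : MemLp F 2 (surfaceMeasure Ω) := hΩ.memLp_surfaceMeasure hFc
  obtain ⟨C, hC⟩ := hΩ.isCompact_closure.exists_bound_of_continuousOn hFc.continuousOn
  have hbound : ∀ k, ∀ x ∈ closure Ω, ‖(mollify F hFc k : E n → ℝ) x‖ ≤ L * 2 + C := by
    intro k x hx
    have h1 := abs_mollify_sub_le hF k x
    have h2 := hC x hx
    rw [Real.norm_eq_abs] at h2 ⊢
    linarith [abs_sub_abs_le_abs_sub ((mollify F hFc k : E n → ℝ) x) (F x)]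
  have t1 : Tendsto (fun k => (hΩ.ofSmooth (mollify F hFc k)).toL2) atTop (𝓝 (m1.toLp F)) := by
    refine tendsto_Lp_of_ae_bounded (C := L * 2 + C) (fun k => ?_) ?_
    · filter_upwards [hΩ.coeFn_ofSmooth (mollify F hFc k),
        ae_restrict_mem hΩ.isOpen.measurableSet] with x h1 h2
      rw [h1]
      exact hbound k x (subset_closure h2)
    · filter_upwards [ae_all_iff.2 fun k => hΩ.coeFn_ofSmooth (mollify F hFc k),
        m1.coeFn_toLp] with x h1 h2
      simp_rw [h1, h2]
      exact tendsto_mollify hFc x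
  have t2 : Tendsto (fun k => (hΩ.ofSmooth (mollify F hFc k)).grad) atTop
      (𝓝 (m2.toLp (gradient F))) := by
    refine tendsto_Lp_of_ae_bounded (C := L) (fun k => ?_) ?_
    · filter_upwards [hΩ.coeFn_grad_ofSmooth (mollify F hFc k)] with x h1
      rw [h1]
      exact norm_gradient_mollify_le hF k x
    · filter_upwards [ae_all_iff.2 fun k => hΩ.coeFn_grad_ofSmooth (mollify F hFc k),
        m2.coeFn_toLp, ae_restrict_of_ae (ae_tendsto_gradient_mollify hF)] with x h1 h2 h3
      simp_rw [h1, h2]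
      exact h3
  have t3 : Tendsto (fun k => hΩ.boundaryValue (mollify F hFc k)) atTop (𝓝 (m3.toLp F)) := by
    refine tendsto_Lp_of_ae_bounded (C := L * 2 + C) (fun k => ?_) ?_
    · filter_upwards [hΩ.coeFn_boundaryValue (mollify F hFc k),
        ae_restrict_mem isClosed_frontier.measurableSet] with x h1 h2
      rw [h1]
      exact hbound k x (frontier_subset_closure h2)
    · filter_upwards [ae_all_iff.2 fun k => hΩ.coeFn_boundaryValue (mollify F hFc k),
        m3.coeFn_toLp] with x h1 h2
      simp_rw [h1, h2]
      exact tendsto_mollify hFc x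
  have hmem : WithLp.toLp 2 (m1.toLp F, m2.toLp (gradient F)) ∈ sobolevH1 Ω :=
    isClosed_sobolevH1.mem_of_tendsto
      (((WithLp.prod_continuous_toLp 2 (L2 Ω) (L2Vec Ω)).tendsto _).comp (t1.prodMk_nhds t2))
      (Eventually.of_forall fun k => (hΩ.ofSmooth (mollify F hFc k)).2)
  have ht : Tendsto (fun k => hΩ.ofSmooth (mollify F hFc k)) atTop (𝓝 (⟨_, hmem⟩ : H1 Ω)) :=
    tendsto_H1_iff.2 ⟨t1, t2⟩
  refine ⟨⟨_, hmem⟩, m3.toLp F, ?_, m1.coeFn_toLp, m2.coeFn_toLp, m3.coeFn_toLp⟩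
  exact mem_closure_of_tendsto (ht.prodMk_nhds t3)
    (Eventually.of_forall fun k => ⟨mollify F hFc k, rfl⟩)

end Mollification

/-! ### The interpolation error -/

section InterpolationError

variable {n : ℕ} {Ω : Set (E n)}

lemma hasFDerivAt_affineMap (p : E n →ᵃ[ℝ] ℝ) (x : E n) :
    HasFDerivAt p (LinearMap.toContinuousLinearMap p.linear) x := by
  rw [AffineMap.decomp p]
  exact (LinearMap.toContinuousLinearMap p.linear).hasFDerivAt.add_const (p 0)

lemma diam_convexHull_pos {s : Finset (E n)} (hcard : s.card = n + 1) (hn : n ≠ 0) :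
    0 < Metric.diam (convexHull ℝ (s : Set (E n))) := by
  obtain ⟨a, ha, b, hb, hab⟩ := Finset.one_lt_card.1 (by omega : 1 < s.card)
  exact (dist_pos.2 hab).trans_le (Metric.dist_le_diam_of_mem
    (isCompact_convexHull_finset s).isBounded (subset_convexHull ℝ _ ha)
    (subset_convexHull ℝ _ hb))

/-- The interpolation error on a simplex, in terms of the oscillation of the gradient. The
difference of the interpolant and of a first order Taylor polynomial is affine, hence is controlled
by its values at the vertices; the shape regularity turns this into a bound of its gradient. -/
lemma interpolation_error {s : Finset (E n)} (hcard : s.card = n + 1) {κ : ℝ} (hκ : 0 < κ) {c : E n}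
    (hball : Metric.closedBall c (κ * Metric.diam (convexHull ℝ (s : Set (E n)))) ⊆
      convexHull ℝ (s : Set (E n))) {p : E n →ᵃ[ℝ] ℝ} {ψ : E n → ℝ} (hp : ∀ v ∈ s, p v = ψ v)
    (hψ : ∀ x, DifferentiableAt ℝ ψ x) {ε : ℝ} {y : E n} (hy : y ∈ convexHull ℝ (s : Set (E n)))
    (hε : ∀ x ∈ convexHull ℝ (s : Set (E n)), ‖fderiv ℝ ψ x - fderiv ℝ ψ y‖ ≤ ε) :
    |p y - ψ y| ≤ ε * Metric.diam (convexHull ℝ (s : Set (E n))) ∧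
      ‖LinearMap.toContinuousLinearMap p.linear - fderiv ℝ ψ y‖ ≤ 2 * ε / κ := by
  set d := Metric.diam (convexHull ℝ (s : Set (E n))) with hd
  have hε0 : 0 ≤ ε := (norm_nonneg _).trans (hε y hy)
  have hbdd := (isCompact_convexHull_finset s).isBounded
  -- the Taylor polynomial of `ψ` at `y`
  let T : E n →ᵃ[ℝ] ℝ := (fderiv ℝ ψ y).toLinearMap.toAffineMap +
    AffineMap.const ℝ (E n) (ψ y - fderiv ℝ ψ y y)
  have hT : ∀ x, T x = ψ y + fderiv ℝ ψ y (x - y) := fun x => by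
    rw [map_sub]
    change fderiv ℝ ψ y x + (ψ y - fderiv ℝ ψ y y) = _
    ring
  have hpT : ∀ x ∈ convexHull ℝ (s : Set (E n)), |(p - T) x| ≤ ε * d := by
    intro x hx
    have hsub : (s : Set (E n)) ⊆ (p - T) ⁻¹' Metric.closedBall 0 (ε * d) := by
      intro v hv
      have hv' := subset_convexHull ℝ _ hv
      rw [mem_preimage, mem_closedBall_zero_iff]
      change ‖p v - T v‖ ≤ _
      rw [hp v hv, hT, ← sub_sub]
      refine ((convex_convexHull ℝ (s : Set (E n))).norm_image_sub_le_of_norm_fderiv_le'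
        (fun x _ => hψ x) hε hy hv').trans ?_
      gcongr
      rw [← dist_eq_norm]
      exact Metric.dist_le_diam_of_mem hbdd hv' hy
    have := convexHull_min hsub ((convex_closedBall (0 : ℝ) (ε * d)).affine_preimage (p - T)) hx
    rwa [mem_preimage, mem_closedBall_zero_iff] at this
  refine ⟨?_, ?_⟩
  · have h := hpT y hy
    change |p y - T y| ≤ _ at h
    rwa [hT, sub_self, map_zero, add_zero] at h
  -- for `n = 0` the simplex is a point and its diameter vanishes
  · rcases eq_or_ne n 0 with rfl | hn
    · rw [Subsingleton.elim (LinearMap.toContinuousLinearMap p.linear) (fderiv ℝ ψ y), sub_self,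
        norm_zero]
      positivity
    have hd0 : 0 < d := diam_convexHull_pos hcard hn
    refine ContinuousLinearMap.opNorm_le_bound _ (by positivity) fun z => ?_
    have h := LinearMap.bound_of_ball_bound' (mul_pos hκ hd0) (2 * (ε * d))
      (LinearMap.toContinuousLinearMap p.linear - fderiv ℝ ψ y).toLinearMap (fun z hz => ?_) z
    · refine h.trans_eq ?_
      field_simp
    · have h1 := hpT (c + z) (hball (by simpa using hz))
      have h2 := hpT c (hball (Metric.mem_closedBall_self (by positivity)))
      have h3 : p (c + z) = p.linear z + p c := by
        rw [add_comm c z]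
        exact p.map_vadd c z
      change |p (c + z) - T (c + z)| ≤ _ at h1
      change |p c - T c| ≤ _ at h2
      rw [h3, hT] at h1
      rw [hT] at h2
      change |p.linear z - fderiv ℝ ψ y z| ≤ _
      simp only [map_sub, map_add] at h1 h2
      rw [abs_le] at h1 h2 ⊢
      constructor <;> linarith [h1.1, h1.2, h2.1, h2.2]

variable {𝒯 : Triangulation Ω}

lemma Triangulation.diam_le_meshSize {s : Finset (E n)} (hs : s ∈ 𝒯.cells) :
    Metric.diam (convexHull ℝ (s : Set (E n))) ≤ 𝒯.meshSize := by
  have hbdd : BddAbove {d : ℝ | ∃ s ∈ 𝒯.cells, ∃ x ∈ s, ∃ y ∈ s, d = dist x y} := by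
    refine (Finite.subset (𝒯.finite_cells.biUnion fun s _ =>
      (s.finite_toSet.biUnion fun x _ => s.finite_toSet.image fun y => dist x y)) ?_).bddAbove
    rintro d ⟨s, hs, x, hx, y, hy, rfl⟩
    exact mem_iUnion₂.2 ⟨s, hs, mem_iUnion₂.2 ⟨x, hx, y, hy, rfl⟩⟩
  have hle : ∀ x ∈ s, ∀ y ∈ s, dist x y ≤ 𝒯.meshSize := fun x hx y hy =>
    le_csSup hbdd ⟨s, hs, x, hx, y, hy, rfl⟩
  rw [convexHull_diam]
  refine Metric.diam_le_of_forall_dist_le ?_ hle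
  obtain ⟨x, hx⟩ : s.Nonempty := Finset.card_pos.1 (by rw [hs.2]; omega)
  exact dist_nonneg.trans (hle x hx x hx)

lemma Triangulation.ae_mem_interior (𝒯 : Triangulation Ω) :
    ∀ᵐ x ∂volume.restrict Ω, x ∈ Ω → ∃ s ∈ 𝒯.cells,
      x ∈ interior (convexHull ℝ (s : Set (E n))) := by
  refine ae_restrict_of_ae ?_
  have h : ∀ᵐ x, ∀ s ∈ 𝒯.cells, x ∉ frontier (convexHull ℝ (s : Set (E n))) :=
    (ae_ball_iff 𝒯.finite_cells.countable).2 fun s _ =>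
      measure_eq_zero_iff_ae_notMem.1 ((convex_convexHull ℝ _).addHaar_frontier volume)
  filter_upwards [h] with x hx hxΩ
  have hc := subset_closure hxΩ
  rw [𝒯.closure_eq] at hc
  obtain ⟨s, hs, hxs⟩ := mem_iUnion₂.1 hc
  refine ⟨s, hs, by_contra fun hi => hx s hs ?_⟩
  rw [(isCompact_convexHull_finset s).isClosed.frontier_eq]
  exact ⟨hxs, hi⟩

/-- On a mesh resolving the oscillation of its gradient, a smooth function is close to its
interpolant, in `H¹(Ω)` and on the boundary. -/
lemma IsPolygonalDomain.exists_interpolant_error (hΩ : IsPolygonalDomain Ω) {κ : ℝ} (hκ : 0 < κ) :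
    ∃ C : ℝ, 0 ≤ C ∧ ∀ (𝒯 : Triangulation Ω) (ψ : smoothFn n) (ε : ℝ),
      (∀ s ∈ 𝒯.cells, ∃ c : E n,
        Metric.closedBall c (κ * Metric.diam (convexHull ℝ (s : Set (E n)))) ⊆
          convexHull ℝ (s : Set (E n))) →
      𝒯.meshSize ≤ 1 → (∀ s ∈ 𝒯.cells, ∀ x ∈ convexHull ℝ (s : Set (E n)),
        ∀ y ∈ convexHull ℝ (s : Set (E n)),
          ‖fderiv ℝ (ψ : E n → ℝ) x - fderiv ℝ (ψ : E n → ℝ) y‖ ≤ ε) → 0 ≤ ε →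
      (∀ x, 0 ≤ (ψ : E n → ℝ) x) →
      ∃ (v : H1 Ω) (γ : Lp ℝ 2 (surfaceMeasure Ω)), (v, γ) ∈ hΩ.traceGraph ∧ v ∈ Kplush 𝒯 ∧
        ‖(v - hΩ.ofSmooth ψ).toL2‖ ≤ C * ε ∧ ‖(v - hΩ.ofSmooth ψ).grad‖ ≤ C * ε ∧
        ‖γ - hΩ.boundaryValue ψ‖ ≤ C * ε := by
  have := hΩ.isFiniteMeasure_restrict
  have := hΩ.isFiniteMeasure_surfaceMeasure
  set A : ℝ := measureUnivNNReal ((volume : Measure (E n)).restrict Ω) ^ (2 : ℝ≥0∞).toReal⁻¹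
    with hA
  set B : ℝ := measureUnivNNReal (surfaceMeasure Ω) ^ (2 : ℝ≥0∞).toReal⁻¹ with hB
  have hA0 : 0 ≤ A := by positivity
  have hB0 : 0 ≤ B := by positivity
  refine ⟨A + B + A * (2 / κ), by positivity, fun 𝒯 ψ ε hreg hmesh hosc hε hψ => ?_⟩
  obtain ⟨F, L, p, hF, hp⟩ := 𝒯.exists_interpolant ψ
  obtain ⟨v, γ, hvγ, hv, hvg, hγ⟩ := hΩ.exists_of_lipschitz hF
  have herr : ∀ s ∈ 𝒯.cells, ∀ x ∈ convexHull ℝ (s : Set (E n)),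
      |F x - (ψ : E n → ℝ) x| ≤ ε ∧ ‖LinearMap.toContinuousLinearMap (p s).linear -
        fderiv ℝ (ψ : E n → ℝ) x‖ ≤ 2 * ε / κ := by
    intro s hs x hx
    obtain ⟨c, hc⟩ := hreg s hs
    obtain ⟨h1, h2⟩ := interpolation_error hs.2 hκ hc (hp s hs).1 (differentiableAt_smoothFn ψ) hx
      fun y hy => hosc s hs y hy x hx
    refine ⟨?_, h2⟩
    rw [(hp s hs).2 hx]
    exact h1.trans (mul_le_of_le_one_right hε ((𝒯.diam_le_meshSize hs).trans hmesh))
  have hcell : ∀ x ∈ closure Ω, ∃ s ∈ 𝒯.cells, x ∈ convexHull ℝ (s : Set (E n)) := fun x hx => by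
    rw [𝒯.closure_eq] at hx
    simpa using hx
  have hFψ : ∀ x ∈ closure Ω, |F x - (ψ : E n → ℝ) x| ≤ ε := fun x hx => by
    obtain ⟨s, hs, hxs⟩ := hcell x hx
    exact (herr s hs x hxs).1
  have hF0 : ∀ x ∈ closure Ω, 0 ≤ F x := fun x hx => by
    obtain ⟨s, hs, hxs⟩ := hcell x hx
    rw [(hp s hs).2 hxs]
    exact convexHull_min (fun v hv => by
      rw [mem_preimage, (hp s hs).1 v hv]
      exact hψ v) ((convex_Ici (0 : ℝ)).affine_preimage (p s)) hxs
  have hgrad : ∀ s ∈ 𝒯.cells, ∀ x ∈ interior (convexHull ℝ (s : Set (E n))),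
      ‖gradient F x - gradient (ψ : E n → ℝ) x‖ ≤ 2 * ε / κ := by
    intro s hs x hx
    have h1 : F =ᶠ[𝓝 x] p s :=
      Filter.eventuallyEq_of_mem (mem_interior_iff_mem_nhds.1 hx) (hp s hs).2
    rw [gradient, gradient, ← map_sub, LinearIsometryEquiv.norm_map, h1.fderiv_eq,
      (hasFDerivAt_affineMap (p s) x).fderiv]
    exact (herr s hs x (interior_subset hx)).2
  refine ⟨v, γ, hvγ, ⟨⟨F, hF.continuous.continuousOn, fun s hs => ⟨p s, (hp s hs).2⟩, hv⟩, ?_⟩,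
    ?_, ?_, ?_⟩
  · change ∀ᵐ x ∂volume.restrict Ω, 0 ≤ v.toL2 x
    filter_upwards [hv, ae_restrict_mem hΩ.isOpen.measurableSet] with x h1 h2
    rw [h1]
    exact hF0 x (subset_closure h2)
  · have h : ‖v.toL2 - (hΩ.ofSmooth ψ).toL2‖ ≤ A * ε := by
      refine Lp.norm_le_of_ae_bound hε ?_
      filter_upwards [hv, ae_restrict_mem hΩ.isOpen.measurableSet, hΩ.coeFn_ofSmooth ψ,
        Lp.coeFn_sub v.toL2 (hΩ.ofSmooth ψ).toL2] with x h1 h2 h3 h4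
      rw [h4, Pi.sub_apply, h1, h3]
      exact hFψ x (subset_closure h2)
    refine h.trans ?_
    gcongr
    rw [add_assoc]
    exact le_add_of_nonneg_right (by positivity)
  · have h : ‖v.grad - (hΩ.ofSmooth ψ).grad‖ ≤ A * (2 * ε / κ) := by
      refine Lp.norm_le_of_ae_bound (by positivity) ?_
      filter_upwards [hvg, ae_restrict_mem hΩ.isOpen.measurableSet, hΩ.coeFn_grad_ofSmooth ψ,
        Lp.coeFn_sub v.grad (hΩ.ofSmooth ψ).grad, 𝒯.ae_mem_interior] with x h1 h2 h3 h4 h5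
      obtain ⟨s, hs, hxs⟩ := h5 h2
      rw [h4, Pi.sub_apply, h1, h3]
      exact hgrad s hs x hxs
    refine h.trans ?_
    rw [add_mul]
    refine le_add_of_nonneg_of_le (by positivity) (le_of_eq (by ring))
  · have h : ‖γ - hΩ.boundaryValue ψ‖ ≤ B * ε := by
      refine Lp.norm_le_of_ae_bound hε ?_
      filter_upwards [hγ, ae_restrict_mem isClosed_frontier.measurableSet,
        hΩ.coeFn_boundaryValue ψ, Lp.coeFn_sub γ (hΩ.boundaryValue ψ)] with x h1 h2 h3 h4
      rw [h4, Pi.sub_apply, h1, h3]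
      exact hFψ x (frontier_subset_closure h2)
    refine h.trans ?_
    gcongr
    rw [add_assoc, add_left_comm]
    exact le_add_of_nonneg_right (by positivity)

lemma H1.norm_le_add (u : H1 Ω) : ‖u‖ ≤ ‖u.toL2‖ + ‖u.grad‖ := by
  refine le_of_sq_le_sq ?_ (by positivity)
  rw [H1.norm_sq]
  nlinarith [norm_nonneg u.toL2, norm_nonneg u.grad]

/-- The cones `K₊ₕ` approximate the nonnegative functions of `H¹(Ω)`, together with their traces. -/
lemma IsPolygonalDomain.eventually_exists_dist_lt (hΩ : IsPolygonalDomain Ω) {ι : Type*}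
    {l : Filter ι} {𝒯 : ι → Triangulation Ω} (hreg : IsRegularFamily 𝒯)
    (hmesh : Tendsto (fun i => (𝒯 i).meshSize) l (𝓝[>] 0)) {u : H1 Ω}
    {w : Lp ℝ 2 (surfaceMeasure Ω)} (huw : (u, w) ∈ hΩ.traceGraph) (hu : u ∈ Kplus Ω) {δ : ℝ}
    (hδ : 0 < δ) : ∀ᶠ i in l, ∃ (v : H1 Ω) (γ : Lp ℝ 2 (surfaceMeasure Ω)),
      (v, γ) ∈ hΩ.traceGraph ∧ v ∈ Kplush (𝒯 i) ∧ ‖v - u‖ ≤ δ ∧ ‖γ - w‖ ≤ δ := by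
  obtain ⟨κ, hκ, hreg⟩ := hreg
  obtain ⟨C, hC0, hC⟩ := hΩ.exists_interpolant_error hκ
  obtain ⟨-, ⟨ψ, hψ, rfl⟩, hdist⟩ := Metric.mem_closure_iff.1 (hΩ.mem_closure_nonneg huw hu)
    (δ / 2) (by positivity)
  rw [Prod.dist_eq, max_lt_iff, dist_comm, dist_comm w, dist_eq_norm, dist_eq_norm] at hdist
  set ε := δ / (4 * (C + 1)) with hεdef
  have hε : 0 < ε := by positivity
  have hCε : C * ε ≤ δ / 4 := by
    rw [hεdef, mul_div_assoc', div_le_div_iff₀ (by positivity) (by positivity)]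
    nlinarith
  have huc := hΩ.isCompact_closure.uniformContinuousOn_of_continuous
    (((contDiff_smoothFn ψ).continuous_fderiv (by simp)).continuousOn)
  obtain ⟨η, hη, hunif⟩ := Metric.uniformContinuousOn_iff_le.1 huc ε hε
  have hev := hmesh.eventually (Ioo_mem_nhdsGT (lt_min hη one_pos))
  filter_upwards [hev] with i hi
  have hsub : ∀ s ∈ (𝒯 i).cells, convexHull ℝ (s : Set (E n)) ⊆ closure Ω := fun s hs => by
    rw [(𝒯 i).closure_eq]
    exact subset_biUnion_of_mem (u := fun t : Finset (E n) => convexHull ℝ (t : Set (E n))) hs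
  obtain ⟨v, γ, h1, h2, h3, h4, h5⟩ := hC (𝒯 i) ψ ε (hreg i) (hi.2.le.trans (min_le_right _ _))
    (fun s hs x hx y hy => by
      rw [← dist_eq_norm]
      refine hunif x (hsub s hs hx) y (hsub s hs hy) ?_
      exact (Metric.dist_le_diam_of_mem (isCompact_convexHull_finset s).isBounded hx hy).trans
        (((𝒯 i).diam_le_meshSize hs).trans (hi.2.le.trans (min_le_left _ _)))) hε.le hψ
  refine ⟨v, γ, h1, h2, ?_, ?_⟩
  · have h6 := norm_sub_le_norm_sub_add_norm_sub v (hΩ.ofSmooth ψ) u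
    have h7 := H1.norm_le_add (v - hΩ.ofSmooth ψ)
    linarith [hdist.1]
  · have h6 := norm_sub_le_norm_sub_add_norm_sub γ (hΩ.boundaryValue ψ) w
    linarith [hdist.2]

end InterpolationError

/-! ### The variational inequalities -/

section Convergence

/-- The error estimate of Falk for variational inequalities: if `x` and `x'` solve the inequalities
tested with `x'` and `y`, the energy of `x' - x` is controlled by the distance of `y` to `x`. -/
lemma norm_sq_sub_le_of_variational_inequalities {X W : Type*} [NormedAddCommGroup X]
    [NormedSpace ℝ X] [NormedAddCommGroup W] [InnerProductSpace ℝ W] (J : X →L[ℝ] W) (ℓ : X →L[ℝ] ℝ)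
    {x x' y : X} (hx : ℓ (x' - x) ≤ ⟪J x, J (x' - x)⟫) (hx' : ℓ (y - x') ≤ ⟪J x', J (y - x')⟫) :
    ‖J (x' - x)‖ ^ 2 ≤ 2 * (‖ℓ‖ + ‖J x‖ * ‖J‖) * ‖y - x‖ + ‖J‖ ^ 2 * ‖y - x‖ ^ 2 := by
  have h1 : ‖J (x' - x)‖ ^ 2 = ⟪J x', J (x' - x)⟫ - ⟪J x, J (x' - x)⟫ := by
    rw [← inner_sub_left, ← map_sub, real_inner_self_eq_norm_sq]
  have h2 : ⟪J x', J (x' - x)⟫ =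
      ⟪J (x' - x), J (y - x)⟫ + ⟪J x, J (y - x)⟫ - ⟪J x', J (y - x')⟫ := by
    rw [← inner_add_left, ← map_add, sub_add_cancel, ← inner_sub_right, ← map_sub,
      sub_sub_sub_cancel_left]
  have h3 : -ℓ (y - x') - ℓ (x' - x) = -ℓ (y - x) := by
    simp only [map_sub]
    ring
  have h4 : -ℓ (y - x) ≤ ‖ℓ‖ * ‖y - x‖ := (neg_le_abs _).trans (ℓ.le_opNorm _)
  have h5 : ‖J (y - x)‖ ≤ ‖J‖ * ‖y - x‖ := J.le_opNorm _
  have h6 : ⟪J x, J (y - x)⟫ ≤ ‖J x‖ * (‖J‖ * ‖y - x‖) :=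
    (real_inner_le_norm _ _).trans (by gcongr)
  have h7 := real_inner_le_norm (J (x' - x)) (J (y - x))
  have h8 : ‖J (y - x)‖ ^ 2 ≤ ‖J‖ ^ 2 * ‖y - x‖ ^ 2 := by
    rw [← mul_pow]
    gcongr
  nlinarith [sq_nonneg (‖J (x' - x)‖ - ‖J (y - x)‖)]

variable {n : ℕ} {Ω : Set (E n)}

lemma setIntegral_mul_sub {Γ : Set (E n)} (f : L2Boundary Ω Γ) {F : E n → ℝ}
    (hF : f =ᵐ[(surfaceMeasure Ω).restrict Γ] F) (γ δ : Lp ℝ 2 (surfaceMeasure Ω)) :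
    ∫ x in Γ, F x * (δ x - γ x) ∂surfaceMeasure Ω =
      ⟪f, LpToLpRestrictCLM (E n) ℝ ℝ (surfaceMeasure Ω) 2 Γ (δ - γ)⟫ := by
  rw [L2.inner_def]
  refine integral_congr_ae ?_
  filter_upwards [hF, LpToLpRestrictCLM_coeFn ℝ Γ (δ - γ),
    ae_restrict_of_ae (s := Γ) (Lp.coeFn_sub δ γ)] with x h1 h2 h3
  rw [h1, h2, h3, Pi.sub_apply]
  exact mul_comm _ _

/-- The map `(u, w) ↦ (∇u, √α w)` with values in `L²(Ω; ℝⁿ) × L²(Γ)`, for which the bilinear form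
`a_α` is the pull-back of the inner product. -/
noncomputable def energyMap (Ω Γ : Set (E n)) (α : ℝ) :
    H1 Ω × Lp ℝ 2 (surfaceMeasure Ω) →L[ℝ] WithLp 2 (L2Vec Ω × L2Boundary Ω Γ) :=
  (WithLp.prodContinuousLinearEquiv 2 ℝ (L2Vec Ω) (L2Boundary Ω Γ)).symm.toContinuousLinearMap ∘L
    ((gradL Ω).prodMap (√α • LpToLpRestrictCLM (E n) ℝ ℝ (surfaceMeasure Ω) 2 Γ))

lemma inner_energyMap {Γ : Set (E n)} {α : ℝ} (hα : 0 ≤ α)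
    (p p' : H1 Ω × Lp ℝ 2 (surfaceMeasure Ω)) :
    ⟪energyMap Ω Γ α p, energyMap Ω Γ α p'⟫ = ⟪p.1.grad, p'.1.grad⟫ +
      α * ⟪LpToLpRestrictCLM (E n) ℝ ℝ (surfaceMeasure Ω) 2 Γ p.2,
        LpToLpRestrictCLM (E n) ℝ ℝ (surfaceMeasure Ω) 2 Γ p'.2⟫ := by
  rw [WithLp.prod_inner_apply]
  change ⟪p.1.grad, p'.1.grad⟫ + ⟪√α • LpToLpRestrictCLM (E n) ℝ ℝ (surfaceMeasure Ω) 2 Γ p.2,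
    √α • LpToLpRestrictCLM (E n) ℝ ℝ (surfaceMeasure Ω) 2 Γ p'.2⟫ = _
  rw [real_inner_smul_left, real_inner_smul_right, ← mul_assoc, Real.mul_self_sqrt hα]

/-- The linear functional `(v, w) ↦ (g, v)_H - (q, w)_Q + α (c, w)_R`. -/
noncomputable def loadMap {Γ₁ Γ₂ : Set (E n)} (α : ℝ) (c : L2Boundary Ω Γ₁) (q : L2Boundary Ω Γ₂)
    (g : L2 Ω) : H1 Ω × Lp ℝ 2 (surfaceMeasure Ω) →L[ℝ] ℝ :=
  innerSL ℝ g ∘L toL2L Ω ∘L ContinuousLinearMap.fst ℝ _ _ -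
    innerSL ℝ q ∘L LpToLpRestrictCLM (E n) ℝ ℝ (surfaceMeasure Ω) 2 Γ₂ ∘L
      ContinuousLinearMap.snd ℝ _ _ +
    α • innerSL ℝ c ∘L LpToLpRestrictCLM (E n) ℝ ℝ (surfaceMeasure Ω) 2 Γ₁ ∘L
      ContinuousLinearMap.snd ℝ _ _

lemma IsPolygonalDomain.solvesVI_iff (hΩ : IsPolygonalDomain Ω) {Γ₁ Γ₂ : Set (E n)} {α b : ℝ}
    (hα : 0 ≤ α) {c : L2Boundary Ω Γ₁} (hc : c =ᵐ[(surfaceMeasure Ω).restrict Γ₁] fun _ => b)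
    (q : L2Boundary Ω Γ₂) (g : L2 Ω) {K : Set (H1 Ω)} {u : H1 Ω} :
    SolvesVI Γ₁ Γ₂ α b q g K u ↔ u ∈ K ∧ ∃ γu, (u, γu) ∈ hΩ.traceGraph ∧ ∀ v ∈ K, ∀ γv,
      (v, γv) ∈ hΩ.traceGraph → loadMap α c q g ((v, γv) - (u, γu)) ≤
        ⟪energyMap Ω Γ₁ α (u, γu), energyMap Ω Γ₁ α ((v, γv) - (u, γu))⟫ := by
  simp_rw [SolvesVI, hΩ.isTrace_iff]
  refine and_congr_right fun _ => exists_congr fun γu => and_congr_right fun _ =>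
    forall₂_congr fun v _ => forall₂_congr fun γv _ => ?_
  rw [setIntegral_mul_sub _ (LpToLpRestrictCLM_coeFn ℝ Γ₁ γu), setIntegral_mul_sub q .rfl,
    setIntegral_mul_sub c hc, inner_energyMap hα, ge_iff_le]
  have h : ∫ x in Ω, g x * (v - u).toL2 x = ⟪g, (v - u).toL2⟫ := by
    rw [L2.inner_def]
    exact integral_congr_ae (ae_of_all _ fun x => mul_comm _ _)
  rw [h, ← L2.inner_def]
  rfl

/-- Coercivity of the bilinear form on the functions of `H¹(Ω)` with their traces. -/
lemma IsPolygonalDomain.exists_norm_sq_le_energyMap (hΩ : IsPolygonalDomain Ω) {Γ : Set (E n)}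
    (hpos : 0 < surfaceMeasure Ω Γ) {α : ℝ} (hα : 0 < α) : ∃ C : ℝ, ∀ p ∈ hΩ.traceGraph,
      ‖p.1‖ ^ 2 ≤ C * ‖energyMap Ω Γ α p‖ ^ 2 := by
  obtain ⟨C, hC0, hC⟩ := hΩ.exists_friedrichs_le hpos
  refine ⟨C * (1 + α⁻¹) + 1, fun p hp => ?_⟩
  have h := hC p hp
  rw [← real_inner_self_eq_norm_sq (energyMap Ω Γ α p), inner_energyMap hα.le,
    real_inner_self_eq_norm_sq, real_inner_self_eq_norm_sq, H1.norm_sq]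
  set G := ‖p.1.grad‖ ^ 2 with hG
  set R := ‖LpToLpRestrictCLM (E n) ℝ ℝ (surfaceMeasure Ω) 2 Γ p.2‖ ^ 2 with hR
  have hG0 : 0 ≤ G := by positivity
  have hR0 : 0 ≤ R := by positivity
  have h1 : (1 + α⁻¹) * (G + α * R) = G + R + (α * R + α⁻¹ * G) := by
    field_simp
    ring
  have h2 : G + R ≤ (1 + α⁻¹) * (G + α * R) := by
    rw [h1]
    exact le_add_of_nonneg_right (by positivity)
  have h3 := mul_le_mul_of_nonneg_left h2 hC0
  have h4 : 0 ≤ α * R := by positivity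
  linarith

end Convergence

end ObstacleFEM

theorem theorem3p1 {n : ℕ} {Ω : Set (E n)} (hΩ : IsPolygonalDomain Ω)
    {Γ₁ Γ₂ : Set (E n)} (hΓ₁ : MeasurableSet Γ₁) (hΓ₂ : MeasurableSet Γ₂)
    (hΓ : Γ₁ ∪ Γ₂ = frontier Ω) (hdisj : Disjoint Γ₁ Γ₂) (hpos : 0 < surfaceMeasure Ω Γ₁)
    {α b : ℝ} (hα : 0 < α) (hb : 0 < b) (q : L2Boundary Ω Γ₂) (g : L2 Ω)
    {ι : Type*} {l : Filter ι} (𝒯 : ι → Triangulation Ω) (hreg : IsRegularFamily 𝒯)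
    (hmesh : Tendsto (fun i => (𝒯 i).meshSize) l (𝓝[>] 0))
    {r : ℝ} (hr₁ : 1 < r) (hr₂ : r ≤ 2)
    {u : H1 Ω} (hu : IsContinuousState Γ₁ Γ₂ α b q g u) (hur : u.MemHr r)
    {uh : ι → H1 Ω} (huh : ∀ i, IsDiscreteState Γ₁ Γ₂ α b q g (𝒯 i) (uh i)) :
    Tendsto uh l (𝓝 u) := by
  have := hΩ.isFiniteMeasure_surfaceMeasure
  have hc := (memLp_const b (μ := (surfaceMeasure Ω).restrict Γ₁) (p := 2)).coeFn_toLp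
  set c : L2Boundary Ω Γ₁ := (memLp_const b).toLp _
  obtain ⟨huK, γ, hγ, hvar⟩ := (hΩ.solvesVI_iff hα.le hc q g).1 hu
  have huh' := fun i => (hΩ.solvesVI_iff hα.le hc q g).1 (huh i)
  choose huhK γh hγh hvarh using huh'
  set J := energyMap Ω Γ₁ α
  set ℓ := loadMap α c q g
  obtain ⟨C, hC⟩ := hΩ.exists_norm_sq_le_energyMap hpos hα
  have henergy : Tendsto (fun i => ‖J ((uh i, γh i) - (u, γ))‖ ^ 2) l (𝓝 0) := by
    set A := 2 * (‖ℓ‖ + ‖J (u, γ)‖ * ‖J‖)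
    have hlim : Tendsto (fun δ : ℝ => A * δ + ‖J‖ ^ 2 * δ ^ 2) (𝓝[>] 0) (𝓝 0) := by
      have h : Continuous fun δ : ℝ => A * δ + ‖J‖ ^ 2 * δ ^ 2 := by fun_prop
      simpa using (h.tendsto 0).mono_left nhdsWithin_le_nhds
    rw [Metric.tendsto_nhds]
    intro ε hε
    obtain ⟨δ, hδε, hδ⟩ := ((hlim.eventually (Iio_mem_nhds hε)).and self_mem_nhdsWithin).exists
    filter_upwards [hΩ.eventually_exists_dist_lt hreg hmesh hγ huK hδ] with i hi
    obtain ⟨v, w, hvw, hv, h1, h2⟩ := hi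
    have h3 : ‖(v, w) - (u, γ)‖ ≤ δ := max_le h1 h2
    rw [Real.dist_0_eq_abs, abs_of_nonneg (sq_nonneg _)]
    refine (norm_sq_sub_le_of_variational_inequalities J ℓ
      (hvar (uh i) (huhK i).2 (γh i) (hγh i)) (hvarh i v hv w hvw)).trans_lt
      (lt_of_le_of_lt ?_ hδε)
    gcongr
  rw [tendsto_iff_norm_sub_tendsto_zero]
  have h := (squeeze_zero (fun i => sq_nonneg _) (fun i =>
    hC ((uh i, γh i) - (u, γ)) (hΩ.traceGraph.sub_mem (hγh i) hγ))
    (by simpa using henergy.const_mul C)).sqrt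
  simpa using h
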